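/- \textbf{Corollary (Kuznetsov--Muravitsky isomorphism for $\sim$-rule systems).} Fix countably many propositional variables. Let $\mathit{Frm}_\sim$ be the set of formulae built from variables by $\bot,\top,\land,\lor,\to,\boxtimes$, and $\mathit{Frm}_{\mathit{clm}}$ the set of formulae built from variables by $\bot,\top,\land,\neg,\square$, with $\varphi\lor\psi$, $\varphi\to\psi$ the usual classical abbreviations and $\square^+\varphi:=\square\varphi\land\varphi$. For $\heartsuit\in\{\sim,\mathit{clm}\}$, a $\heartsuit$-rule $\Gamma/\Delta$ is a pair of finite sets of $\heartsuit$-formulae, and a $\heartsuit$-rule system is a set of $\heartsuit$-rules that is closed under substitution, monotonicity (adding finitely many formulae on either side) and cut (from $\Gamma/\Delta;\varphi$ and $\Gamma;\varphi/\Delta$ infer $\Gamma/\Delta$), and contains $\varphi/\varphi$, $\varphi,\varphi\to\psi/\psi$ and $\varphi/{\odot\varphi}$ for all $\varphi,\psi$, where $\odot=\boxtimes$ if $\heartsuit={\sim}$ and $\odot=\square$ if $\heartsuit=\mathit{clm}$. Write $\mathsf S\oplus\Xi$ for the least rule system containing $\mathsf S$ and $\Xi$, and $\mathbf{NExt}(\mathsf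 S)$ for the complete lattice, under inclusion, of all rule systems extending $\mathsf S$. Let $\mathsf{mHC}$ be the least $\sim$-rule system containing $/\varphi$ for every theorem $\varphi$ of the intuitionistic propositional calculus as well as $/\boxtimes(p\to q)\to(\boxtimes p\to\boxtimes q)$, $/p\to\boxtimes p$ and $/\boxtimes p\to(q\lor(q\to p))$, and let $\mathsf{KM}:=\mathsf{mHC}\oplus\{/(\boxtimes p\to p)\to p\}$. Let $\mathsf{K4}$ be the least $\mathit{clm}$-rule system containing $/\varphi$ for every $\varphi$ valid in all transitive Kripke frames, $\mathsf{K4.Grz}:=\mathsf{K4}\oplus\{/\square(\square(p\to\square p)\to p)\to\square p\}$ and $\mathsf{GL}:=\mathsf{K4}\oplus\{/\square(\square p\to p)\to\square p\}$. Define $T:\mathit{Frm}_\sim\to\mathit{Frm}_{\mathit{clm}}$ by $T(p):=\square^+p$, $T(\varphi\to\psi):=\square^+(\neg T(\varphi)\lor T(\psi))$, $T(\boxtimes\varphi):=\square T(\varphi)$, with $T$ commuting with $\bot,\top,\land,\lor$, and put $T(\Gamma/\Delta):=T[\Gamma]/T[\Delta]$. For a $\sim$-rule system $\mathsf L$ and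 a $\mathit{clm}$-rule system $\mathsf M$, put \[\tau\mathsf L:=\mathsf{K4}\oplus\{T(\Gamma/\Delta):\Gamma/\Delta\in\mathsf L\},\qquad \sigma\mathsf L:=\mathsf{K4.Grz}\oplus\tau\mathsf L,\qquad \rho\mathsf M:=\{\Gamma/\Delta : T(\Gamma/\Delta)\in\mathsf M\}.\] Then $\sigma\mathsf{KM}=\mathsf{GL}$. Moreover, $\sigma$ maps $\mathbf{NExt}(\mathsf{KM})$ into $\mathbf{NExt}(\mathsf{GL})$, $\rho$ maps $\mathbf{NExt}(\mathsf{GL})$ into $\mathbf{NExt}(\mathsf{KM})$, and the restrictions of $\sigma$ to $\mathbf{NExt}(\mathsf{KM})$ and of $\rho$ to $\mathbf{NExt}(\mathsf{GL})$ are mutually inverse complete lattice isomorphisms between $\mathbf{NExt}(\mathsf{KM})$ and $\mathbf{NExt}(\mathsf{GL})$, that is, mutually inverse order isomorphisms preserving arbitrary joins and meets. -/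

import Mathlib

namespace ModalRules

/-! ### Rule systems over a modal language -/

/-- The syntactic operations on a set of formulae `F` (with variables indexed by `ℕ`) that enter
the definition of a rule system: substitution, implication and the necessity-like operator. It is
only used for the two concrete languages `SimForm` and `ClmForm` below. -/
class ModalLanguage (F : Type) where
  /-- The unique extension of an assignment of formulae to variables commuting with all
  primitive connectives. -/
  subst : (ℕ → F) → F → F
  imp : F → F → F
  box : F → F

/-- A (multi-conclusion) rule `Γ / Δ` is a pair of finite sets of formulae. -/
abbrev Rule (F : Type) : Type := Finset F × Finset F

/-- The assumption-free single-conclusion rule `/φ`. -/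
def ax {F : Type} (φ : F) : Rule F := (∅, {φ})

/-- Rule systems. -/
@[ext]
structure RuleSystem (F : Type) [DecidableEq F] [ModalLanguage F] where
  rules : Set (Rule F)
  structurality : ∀ (s : ℕ → F) (Γ Δ : Finset F), (Γ, Δ) ∈ rules →
    (Γ.image (ModalLanguage.subst s), Δ.image (ModalLanguage.subst s)) ∈ rules
  reflexivity : ∀ φ : F, ({φ}, {φ}) ∈ rules
  monotonicity : ∀ Γ Δ Γ' Δ' : Finset F, (Γ, Δ) ∈ rules → (Γ ∪ Γ', Δ ∪ Δ') ∈ rules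
  cut : ∀ (Γ Δ : Finset F) (φ : F),
    (Γ, insert φ Δ) ∈ rules → (insert φ Γ, Δ) ∈ rules → (Γ, Δ) ∈ rules
  modus_ponens : ∀ φ ψ : F, ({φ, ModalLanguage.imp φ ψ}, {ψ}) ∈ rules
  necessitation : ∀ φ : F, ({φ}, {ModalLanguage.box φ}) ∈ rules

namespace RuleSystem

variable {F : Type} [DecidableEq F] [ModalLanguage F]

/-- Rule systems are ordered by inclusion. -/
instance : PartialOrder (RuleSystem F) where
  le S S' := S.rules ⊆ S'.rules
  le_refl _ := subset_rfl
  le_trans _ _ _ h h' := h.trans h'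
  le_antisymm _ _ h h' := RuleSystem.ext (h.antisymm h')

/-- The meet of a set of rule systems is its intersection. -/
instance : InfSet (RuleSystem F) where
  sInf 𝒮 :=
    { rules := {r | ∀ S ∈ 𝒮, r ∈ S.rules}
      structurality := fun s Γ Δ h S hS => S.structurality s Γ Δ (h S hS)
      reflexivity := fun φ S _ => S.reflexivity φ
      monotonicity := fun Γ Δ Γ' Δ' h S hS => S.monotonicity Γ Δ Γ' Δ' (h S hS)
      cut := fun Γ Δ φ h h' S hS => S.cut Γ Δ φ (h S hS) (h' S hS)
      modus_ponens := fun φ ψ S _ => S.modus_ponens φ ψ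
      necessitation := fun φ S _ => S.necessitation φ }

theorem isGLB_sInf (𝒮 : Set (RuleSystem F)) : IsGLB 𝒮 (sInf 𝒮) :=
  ⟨fun _ hS _ hr => hr _ hS, fun _ hT _ hr _ hS => hT hS hr⟩

/-- The complete lattice of all rule systems. -/
instance : CompleteLattice (RuleSystem F) := completeLatticeOfInf _ isGLB_sInf

/-- The least rule system containing a given set of rules. -/
def generate (Ξ : Set (Rule F)) : RuleSystem F := sInf {S | Ξ ⊆ S.rules}

theorem isLeast_generate (Ξ : Set (Rule F)) :
    IsLeast {S : RuleSystem F | Ξ ⊆ S.rules} (generate Ξ) :=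
  ⟨fun _ hr _ hS => hS hr, fun _ hS _ hr => hr _ hS⟩

/-- `S ⊕ Ξ`: the least rule system extending the rule system `S` and the set of rules `Ξ`. -/
def adjoin (S : RuleSystem F) (Ξ : Set (Rule F)) : RuleSystem F := generate (S.rules ∪ Ξ)

end RuleSystem

/-- `NExt(S)`: the rule systems extending `S`, ordered by inclusion. -/
def NExt {F : Type} [DecidableEq F] [ModalLanguage F] (S : RuleSystem F) : Type :=
  {S' : RuleSystem F // S ≤ S'}

namespace NExt

variable {F : Type} [DecidableEq F] [ModalLanguage F] {S : RuleSystem F}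

/-- The rule system underlying an element of `NExt(S)`. -/
def toRuleSystem (L : NExt S) : RuleSystem F := L.1

instance : PartialOrder (NExt S) := inferInstanceAs (PartialOrder {S' : RuleSystem F // S ≤ S'})

instance : InfSet (NExt S) where
  sInf 𝒮 := ⟨sInf (toRuleSystem '' 𝒮), le_sInf (by rintro _ ⟨L, _, rfl⟩; exact L.2)⟩

theorem isGLB_sInf (𝒮 : Set (NExt S)) : IsGLB 𝒮 (sInf 𝒮) :=
  ⟨fun L hL => sInf_le (a := L.1) ⟨L, hL, rfl⟩,
    fun M hM => le_sInf (a := M.1) (by rintro _ ⟨L, hL, rfl⟩; exact hM hL)⟩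

/-- `NExt(S)` is a complete lattice: the meet of a set of extensions is the greatest extension of
`S` contained in all of them, the join is the least extension of `S` containing all of them. -/
instance : CompleteLattice (NExt S) := completeLatticeOfInf _ isGLB_sInf

end NExt

/-! ### Superintuitionistic modal formulae and the systems mHC and KM -/

/-- Formulae of the intuitionistic propositional calculus. -/
inductive IntForm : Type
  | var : ℕ → IntForm
  | bot : IntForm
  | top : IntForm
  | and : IntForm → IntForm → IntForm
  | or : IntForm → IntForm → IntForm
  | imp : IntForm → IntForm → IntForm

/-- Theorems of the intuitionistic propositional calculus (Hilbert-style axiomatization). -/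
inductive IPC : IntForm → Prop
  | k (φ ψ : IntForm) : IPC (φ.imp (ψ.imp φ))
  | s (φ ψ χ : IntForm) : IPC ((φ.imp (ψ.imp χ)).imp ((φ.imp ψ).imp (φ.imp χ)))
  | and_left (φ ψ : IntForm) : IPC ((φ.and ψ).imp φ)
  | and_right (φ ψ : IntForm) : IPC ((φ.and ψ).imp ψ)
  | and_intro (φ ψ : IntForm) : IPC (φ.imp (ψ.imp (φ.and ψ)))
  | or_left (φ ψ : IntForm) : IPC (φ.imp (φ.or ψ))
  | or_right (φ ψ : IntForm) : IPC (ψ.imp (φ.or ψ))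
  | or_elim (φ ψ χ : IntForm) : IPC ((φ.imp χ).imp ((ψ.imp χ).imp ((φ.or ψ).imp χ)))
  | ex_falso (φ : IntForm) : IPC (IntForm.bot.imp φ)
  | top_intro : IPC IntForm.top
  | mp {φ ψ : IntForm} : IPC (φ.imp ψ) → IPC φ → IPC ψ

/-- Superintuitionistic modal formulae; `box` is the modality `⊠`. -/
inductive SimForm : Type
  | var : ℕ → SimForm
  | bot : SimForm
  | top : SimForm
  | and : SimForm → SimForm → SimForm
  | or : SimForm → SimForm → SimForm
  | imp : SimForm → SimForm → SimForm
  | box : SimForm → SimForm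
  deriving DecidableEq

namespace SimForm

/-- Simultaneous substitution. -/
def subst (s : ℕ → SimForm) : SimForm → SimForm
  | var n => s n
  | bot => bot
  | top => top
  | and φ ψ => and (subst s φ) (subst s ψ)
  | or φ ψ => or (subst s φ) (subst s ψ)
  | imp φ ψ => imp (subst s φ) (subst s ψ)
  | box φ => box (subst s φ)

instance : ModalLanguage SimForm where
  subst := subst
  imp := imp
  box := box

end SimForm

/-- Intuitionistic formulae as `⊠`-free superintuitionistic modal formulae. -/
def IntForm.toSim : IntForm → SimForm
  | var n => .var n
  | bot => .bot
  | top => .top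
  | and φ ψ => .and φ.toSim ψ.toSim
  | or φ ψ => .or φ.toSim ψ.toSim
  | imp φ ψ => .imp φ.toSim ψ.toSim

section Sim

open SimForm

/-- The modalized Heyting calculus. -/
def mHC : RuleSystem SimForm :=
  RuleSystem.generate
    ({r | ∃ φ : IntForm, IPC φ ∧ r = ax φ.toSim} ∪
      {ax (imp (box (imp (var 0) (var 1))) (imp (box (var 0)) (box (var 1)))),
        ax (imp (var 0) (box (var 0))),
        ax (imp (box (var 0)) (or (var 1) (imp (var 1) (var 0))))})

/-- The Kuznetsov–Muravitsky system: `mHC` extended by `/(⊠p → p) → p`. -/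
def KMSystem : RuleSystem SimForm :=
  mHC.adjoin {ax (imp (imp (box (var 0)) (var 0)) (var 0))}

end Sim

/-! ### Classical modal formulae and the systems K4, K4.Grz and GL -/

/-- Classical modal formulae. -/
inductive ClmForm : Type
  | var : ℕ → ClmForm
  | bot : ClmForm
  | top : ClmForm
  | and : ClmForm → ClmForm → ClmForm
  | neg : ClmForm → ClmForm
  | box : ClmForm → ClmForm
  deriving DecidableEq

namespace ClmForm

/-- `φ ∨ ψ` abbreviates `¬(¬φ ∧ ¬ψ)`. -/
def or (φ ψ : ClmForm) : ClmForm := neg (and (neg φ) (neg ψ))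

/-- `φ → ψ` abbreviates `¬φ ∨ ψ`. -/
def imp (φ ψ : ClmForm) : ClmForm := or (neg φ) ψ

/-- `□⁺φ` abbreviates `□φ ∧ φ`. -/
def boxPlus (φ : ClmForm) : ClmForm := and (box φ) φ

/-- Simultaneous substitution. -/
def subst (s : ℕ → ClmForm) : ClmForm → ClmForm
  | var n => s n
  | bot => bot
  | top => top
  | and φ ψ => and (subst s φ) (subst s ψ)
  | neg φ => neg (subst s φ)
  | box φ => box (subst s φ)

instance : ModalLanguage ClmForm where
  subst := subst
  imp := imp
  box := box

/-- Truth at a world of the Kripke frame `(W, R)` under the interpretation `V` of variables. -/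
def Holds {W : Type} (R : W → W → Prop) (V : ℕ → Set W) : W → ClmForm → Prop
  | x, var n => x ∈ V n
  | _, bot => False
  | _, top => True
  | x, and φ ψ => Holds R V x φ ∧ Holds R V x ψ
  | x, neg φ => ¬ Holds R V x φ
  | x, box φ => ∀ y, R x y → Holds R V y φ

/-- Validity in all transitive Kripke frames. -/
def TransValid (φ : ClmForm) : Prop :=
  ∀ (W : Type) (R : W → W → Prop), (∀ x y z, R x y → R y z → R x z) →
    ∀ (V : ℕ → Set W) (x : W), Holds R V x φ

end ClmForm

section Clm

open ClmForm

/-- `K4`: the least rule system containing `/φ` for all `φ` valid in all transitive frames. -/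
def K4 : RuleSystem ClmForm :=
  RuleSystem.generate {r | ∃ φ : ClmForm, TransValid φ ∧ r = ax φ}

/-- `K4.Grz`: `K4` extended by `/□(□(p → □p) → p) → □p`. -/
def K4Grz : RuleSystem ClmForm :=
  K4.adjoin {ax (imp (box (imp (box (imp (var 0) (box (var 0)))) (var 0))) (box (var 0)))}

/-- `GL`: `K4` extended by `/□(□p → p) → □p`. -/
def GLSystem : RuleSystem ClmForm :=
  K4.adjoin {ax (imp (box (imp (box (var 0)) (var 0))) (box (var 0)))}

end Clm

/-! ### The translation and the maps between rule systems -/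

/-- The translation `T` of superintuitionistic modal formulae into classical modal formulae. -/
def translate : SimForm → ClmForm
  | .var n => (ClmForm.var n).boxPlus
  | .bot => .bot
  | .top => .top
  | .and φ ψ => .and (translate φ) (translate ψ)
  | .or φ ψ => .or (translate φ) (translate ψ)
  | .imp φ ψ => (ClmForm.or (.neg (translate φ)) (translate ψ)).boxPlus
  | .box φ => .box (translate φ)

/-- `T(Γ/Δ) = T[Γ]/T[Δ]`. -/
def translateRule (r : Rule SimForm) : Rule ClmForm :=
  (r.1.image translate, r.2.image translate)

/-- `τL = K4 ⊕ {T(Γ/Δ) : Γ/Δ ∈ L}`. -/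
def tau (L : RuleSystem SimForm) : RuleSystem ClmForm := K4.adjoin (translateRule '' L.rules)

/-- `σL = K4.Grz ⊕ τL`. -/
def sigma (L : RuleSystem SimForm) : RuleSystem ClmForm := K4Grz.adjoin (tau L).rules

/-- `ρM = {Γ/Δ : T(Γ/Δ) ∈ M}`, as a set of rules. -/
def rho (M : RuleSystem ClmForm) : Set (Rule SimForm) := {r | translateRule r ∈ M.rules}

end ModalRules

/-! Everything reduces to two facts: `ρ(σL) = L` for `L` above KM, and a system `M` above GL is
determined by `ρM`.

For the first (`rho_sigma_subset`), a rule `Γ/Δ` outside `L` yields, by Zorn, an `L`-saturated set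
`X` containing `Γ` and disjoint from `Δ`. The prime theories over `X` form a canonical model in
which global truth is membership in `X`. Interpreting classical variables by Boolean combinations of
truth sets of superintuitionistic formulae gives a general frame, because `□` of such a combination
is the truth set of a single `⊠`-formula. The KM axiom makes Löb's axiom valid on it and saturation
makes the translated rules of `L` valid, so it validates `σL`; yet it refutes `T(Γ/Δ)`.

For the second (`le_of_rho_subset`), the difficulty is that translations only see upsets. Fix a
finite subformula-closed set `Θ`; the type of a point is the set of members of `Θ` true there. Let
`q_S` say that the type `S` occurs neither here nor above. By Löb, every type that occurs has a last
occurrence, and at a last occurrence `S` is recognised by `⊠q_S` true and `q_S` false. At any other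
point, choose a type realized strictly above that has the right boxed members. The resulting
valuation is a Boolean combination of the `q_S` and `⊠q_S`, and it makes the same members of `Θ`
globally true as the original one. Hence every rule is, modulo GL, a substitution instance of a rule
interderivable with a translation.

Finally `σKM = GL`: over transitive models the translated KM axiom globally implies Löb's axiom for
`p`, and Löb's axiom for `T(p)` gives the translated KM axiom back. -/

namespace ModalRules

/-! ### Multi-conclusion cuts and saturated sets. -/

namespace RuleSystem

section Cut

variable {F : Type} [DecidableEq F] [ModalLanguage F] (S : RuleSystem F)

theorem mono {Γ Δ Γ' Δ' : Finset F} (h : (Γ, Δ) ∈ S.rules) (hΓ : Γ ⊆ Γ') (hΔ : Δ ⊆ Δ') :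
    (Γ', Δ') ∈ S.rules := by
  have := S.monotonicity Γ Δ Γ' Δ' h
  rwa [Finset.union_eq_right.2 hΓ, Finset.union_eq_right.2 hΔ] at this

theorem cut_left {Γ Δ : Finset F} (Γ₀ : Finset F) (h : (Γ₀ ∪ Γ, Δ) ∈ S.rules)
    (h₀ : ∀ γ ∈ Γ₀, (Γ, {γ}) ∈ S.rules) : (Γ, Δ) ∈ S.rules := by
  induction Γ₀ using Finset.induction_on with
  | empty => simpa using h
  | insert a s _ ih =>
    refine ih ?_ fun γ hγ => h₀ γ (Finset.mem_insert_of_mem hγ)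
    refine S.cut _ _ a (S.mono (h₀ a (Finset.mem_insert_self a s)) Finset.subset_union_right
      (by simp)) ?_
    rwa [Finset.insert_union] at h

theorem cut_right {Γ Δ : Finset F} (Δ₀ : Finset F) (h : (Γ, Δ₀ ∪ Δ) ∈ S.rules)
    (h₀ : ∀ δ ∈ Δ₀, (insert δ Γ, Δ) ∈ S.rules) : (Γ, Δ) ∈ S.rules := by
  induction Δ₀ using Finset.induction_on with
  | empty => simpa using h
  | insert a s _ ih =>
    refine ih ?_ fun δ hδ => h₀ δ (Finset.mem_insert_of_mem hδ)
    refine S.cut _ _ a (by rwa [Finset.insert_union] at h) (S.mono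
      (h₀ a (Finset.mem_insert_self a s)) subset_rfl Finset.subset_union_right)

/-- Premises may be strengthened and conclusions weakened along derivable rules. -/
theorem of_derivable {Γ Δ Γ₀ Δ₀ : Finset F} (h : (Γ₀, Δ₀) ∈ S.rules)
    (hΓ : ∀ γ ∈ Γ₀, (Γ, {γ}) ∈ S.rules) (hΔ : ∀ δ ∈ Δ₀, ({δ}, Δ) ∈ S.rules) :
    (Γ, Δ) ∈ S.rules := by
  refine S.cut_right Δ₀ ?_ fun δ hδ => S.mono (hΔ δ hδ) (by simp) subset_rfl
  exact S.cut_left Γ₀ (S.mono h Finset.subset_union_left Finset.subset_union_left) hΓ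

theorem image_of_derivable {G : Type} {Γ Δ : Finset G} {f g : G → F}
    (h : (Γ.image f, Δ.image f) ∈ S.rules) (hΓ : ∀ γ ∈ Γ, ({g γ}, {f γ}) ∈ S.rules)
    (hΔ : ∀ δ ∈ Δ, ({f δ}, {g δ}) ∈ S.rules) : (Γ.image g, Δ.image g) ∈ S.rules := by
  refine S.of_derivable h ?_ ?_ <;> simp only [Finset.forall_mem_image] <;> intro φ hφ
  · exact S.mono (hΓ φ hφ) (by simpa using ⟨φ, hφ, rfl⟩) subset_rfl
  · exact S.mono (hΔ φ hφ) subset_rfl (by simpa using ⟨φ, hφ, rfl⟩)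

theorem derives_mp {Γ : Finset F} {φ ψ : F} (h : (Γ, {ModalLanguage.imp φ ψ}) ∈ S.rules)
    (h' : (Γ, {φ}) ∈ S.rules) : (Γ, {ψ}) ∈ S.rules :=
  S.of_derivable (S.modus_ponens φ ψ) (by simp [h, h']) (by simp [S.reflexivity])

theorem derives_box {Γ : Finset F} {φ : F} (h : (Γ, {φ}) ∈ S.rules) :
    (Γ, {ModalLanguage.box φ}) ∈ S.rules :=
  S.of_derivable (S.necessitation φ) (by simp [h]) (by simp [S.reflexivity])

theorem derives_ax {Γ : Finset F} {φ : F} (h : ax φ ∈ S.rules) : (Γ, {φ}) ∈ S.rules :=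
  S.mono h (by simp) subset_rfl

theorem ax_subst {φ : F} (h : ax φ ∈ S.rules) (s : ℕ → F) :
    ax (ModalLanguage.subst s φ) ∈ S.rules := by
  simpa [ax] using S.structurality s _ _ h

/-- A set of formulae closed under all rules of `S`, in the multi-conclusion sense. -/
def Saturated (X : Set F) : Prop :=
  ∀ Γ Δ : Finset F, (Γ, Δ) ∈ S.rules → ↑Γ ⊆ X → ∃ δ ∈ Δ, δ ∈ X

/-- Zorn applied to the supersets of `Γ` no finite part of which derives `Δ`; such sets are closed
under unions of chains because premises are finite. Maximality plus repeated cut gives saturation.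
-/
theorem exists_saturated {Γ Δ : Finset F} (h : (Γ, Δ) ∉ S.rules) :
    ∃ X : Set F, S.Saturated X ∧ ↑Γ ⊆ X ∧ ∀ δ ∈ Δ, δ ∉ X := by
  obtain ⟨X, hΓX, hX⟩ := zorn_subset_nonempty
    {X : Set F | ∀ Γ' : Finset F, ↑Γ' ⊆ X → (Γ', Δ) ∉ S.rules} (by
      intro c hc hchain hne
      refine ⟨⋃₀ c, fun Γ' hΓ' hr => ?_, fun s hs => Set.subset_sUnion_of_mem hs⟩
      rw [Set.sUnion_eq_biUnion] at hΓ'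
      obtain ⟨Y, hY, hΓY⟩ := DirectedOn.exists_mem_subset_of_finset_subset_biUnion hne
        hchain.directedOn hΓ'
      exact hc hY Γ' hΓY hr) (Γ : Set F)
    (fun Γ' hΓ' hr => h (S.mono hr (by exact_mod_cast hΓ') subset_rfl))
  refine ⟨X, fun Γ' Δ' hr hΓ' => ?_, hΓX, fun δ hδ hδX => ?_⟩
  · by_contra! hcon
    -- By maximality, adding a conclusion `δ` outside `X` makes `Δ` derivable. Cutting all these
    -- derivations against `Γ'/Δ'` derives `Δ` from `X` itself.
    have key : ∀ δ ∈ Δ', ∃ Γ'' : Finset F, ↑Γ'' ⊆ X ∧ (insert δ Γ'', Δ) ∈ S.rules := by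
      intro δ hδ
      by_contra! hno
      refine hcon δ hδ (hX.2 (y := insert δ X) ?_ (Set.subset_insert δ X) (Set.mem_insert δ X))
      intro Γ'' hΓ'' hr''
      refine hno (Γ''.erase δ) ?_ (S.mono hr'' (Finset.insert_erase_subset δ Γ'') subset_rfl)
      intro φ hφ
      have hφ' := Finset.mem_erase.1 hφ
      exact (hΓ'' hφ'.2).resolve_left hφ'.1
    choose! G hGX hG using key
    refine hX.1 (Γ' ∪ Δ'.biUnion G) ?_ (S.cut_right Δ' (S.mono hr Finset.subset_union_left
      Finset.subset_union_left) fun δ hδ => S.mono (hG δ hδ) (Finset.insert_subset_insert _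
        ((Finset.subset_biUnion_of_mem G hδ).trans Finset.subset_union_right)) subset_rfl)
    simpa using ⟨hΓ', hGX⟩
  · exact hX.1 {δ} (by simpa using hδX) (S.mono (S.reflexivity δ) subset_rfl (by simpa using hδ))

end Cut

theorem subset_generate {F : Type} [DecidableEq F] [ModalLanguage F] (Ξ : Set (Rule F)) :
    Ξ ⊆ (generate Ξ).rules := (isLeast_generate Ξ).1

theorem generate_le {F : Type} [DecidableEq F] [ModalLanguage F] {Ξ : Set (Rule F)}
    {S : RuleSystem F} (h : Ξ ⊆ S.rules) : generate Ξ ≤ S := (isLeast_generate Ξ).2 h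

theorem le_adjoin {F : Type} [DecidableEq F] [ModalLanguage F] (S : RuleSystem F)
    (Ξ : Set (Rule F)) : S ≤ S.adjoin Ξ :=
  Set.subset_union_left.trans (subset_generate _)

theorem subset_adjoin {F : Type} [DecidableEq F] [ModalLanguage F] (S : RuleSystem F)
    (Ξ : Set (Rule F)) : Ξ ⊆ (S.adjoin Ξ).rules :=
  Set.subset_union_right.trans (subset_generate _)

theorem adjoin_le {F : Type} [DecidableEq F] [ModalLanguage F] {S S' : RuleSystem F}
    {Ξ : Set (Rule F)} (h : S ≤ S') (h' : Ξ ⊆ S'.rules) : S.adjoin Ξ ≤ S' :=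
  generate_le (Set.union_subset h h')

end RuleSystem

/-! ### Kripke semantics of classical modal formulae. -/

namespace ClmForm

section Semantics

variable {W : Type} {R : W → W → Prop} {V : ℕ → Set W} {x : W}

@[simp] theorem holds_var {n : ℕ} : Holds R V x (var n) ↔ x ∈ V n := Iff.rfl

@[simp] theorem holds_bot : Holds R V x bot ↔ False := Iff.rfl

@[simp] theorem holds_top : Holds R V x top ↔ True := Iff.rfl

@[simp] theorem holds_and {φ ψ : ClmForm} :
    Holds R V x (and φ ψ) ↔ Holds R V x φ ∧ Holds R V x ψ := Iff.rfl

@[simp] theorem holds_neg {φ : ClmForm} : Holds R V x (neg φ) ↔ ¬ Holds R V x φ := Iff.rfl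

@[simp] theorem holds_box {φ : ClmForm} :
    Holds R V x (box φ) ↔ ∀ y, R x y → Holds R V y φ := Iff.rfl

@[simp] theorem holds_or {φ ψ : ClmForm} :
    Holds R V x (or φ ψ) ↔ Holds R V x φ ∨ Holds R V x ψ := by
  simp only [or, holds_neg, holds_and]; tauto

@[simp] theorem holds_imp {φ ψ : ClmForm} :
    Holds R V x (imp φ ψ) ↔ (Holds R V x φ → Holds R V x ψ) := by
  simp only [imp, holds_neg, holds_or]; tauto

theorem holds_boxPlus {φ : ClmForm} :
    Holds R V x (boxPlus φ) ↔ ∀ y, x = y ∨ R x y → Holds R V y φ := by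
  simp only [boxPlus, holds_and, holds_box]
  constructor
  · rintro ⟨h, h'⟩ y (rfl | hy)
    exacts [h', h y hy]
  · exact fun h => ⟨fun y hy => h y (Or.inr hy), h x (Or.inl rfl)⟩

theorem holds_subst {s : ℕ → ClmForm} {φ : ClmForm} :
    Holds R V x (subst s φ) ↔ Holds R (fun n => {y | Holds R V y (s n)}) x φ := by
  induction φ generalizing x <;> simp_all [subst]

/-- Generated submodels preserve truth. This is what turns `□⁺θ` at one point into global truth of
`θ`. -/
theorem holds_restrict {p : W → Prop} (hp : ∀ x y, p x → R x y → p y) {φ : ClmForm}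
    (x : Subtype p) :
    Holds (fun a b : Subtype p => R a b) (fun n => {a | (a : W) ∈ V n}) x φ ↔
      Holds R V x φ := by
  induction φ generalizing x with
  | box φ ih =>
    simp only [holds_box, ih, Subtype.forall]
    exact forall_congr' fun y => ⟨fun h hy => h (hp _ _ x.2 hy) hy, fun h _ hy => h hy⟩
  | _ => simp_all

/-- The conjunction of a list of formulae. -/
def conj : List ClmForm → ClmForm
  | [] => top
  | φ :: l => and φ (conj l)

theorem holds_conj {l : List ClmForm} : Holds R V x (conj l) ↔ ∀ φ ∈ l, Holds R V x φ := by
  induction l <;> simp_all [conj]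

/-- The formula saying that the set of those `i ∈ Q` for which `f i` is true satisfies `P`. -/
noncomputable def ofPred {ι : Type} (Q : Finset ι) (f : ι → ClmForm) (P : Finset ι → Prop) :
    ClmForm :=
  open Classical in
  neg (conj ((Q.powerset.filter P).toList.map fun A =>
    neg (and (conj (A.toList.map f)) (conj ((Q \ A).toList.map fun i => neg (f i))))))

open Classical in
theorem holds_ofPred {ι : Type} {Q : Finset ι} {f : ι → ClmForm} {P : Finset ι → Prop} :
    Holds R V x (ofPred Q f P) ↔ P (Q.filter fun i => Holds R V x (f i)) := by
  simp only [ofPred, holds_neg, holds_conj, List.forall_mem_map, holds_and, Finset.mem_toList,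
    Finset.mem_filter, Finset.mem_powerset, Finset.mem_sdiff, not_forall, not_not]
  constructor
  · rintro ⟨A, ⟨hA, hP⟩, h, h'⟩
    convert hP
    ext i
    rw [Finset.mem_filter]
    refine ⟨fun ⟨hi, hx⟩ => ?_, fun hi => ⟨hA hi, h i hi⟩⟩
    by_contra hiA
    exact h' i ⟨hi, hiA⟩ hx
  · intro hP
    refine ⟨_, ⟨Finset.filter_subset _ _, hP⟩, ?_, ?_⟩ <;> simp
    tauto

end Semantics

/-- The instance of Löb's axiom for `φ`. -/
def loeb (φ : ClmForm) : ClmForm := imp (box (imp (box φ) φ)) (box φ)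

/-- Truth of an instance of Löb's axiom yields points at which `φ` fails for the last time. -/
theorem exists_last {W : Type} {R : W → W → Prop} {V : ℕ → Set W} {φ : ClmForm}
    {x : W} (h : Holds R V x (loeb φ)) {y : W} (hxy : R x y) (hy : ¬ Holds R V y φ) :
    ∃ z, R x z ∧ ¬ Holds R V z φ ∧ ∀ w, R z w → Holds R V w φ := by
  by_contra! hcon
  simp only [loeb, holds_imp, holds_box] at h
  refine hy (h (fun z hz hb => ?_) y hxy)
  by_contra hzφ
  obtain ⟨w, hzw, hw⟩ := hcon z hz hzφ
  exact hw (hb w hzw)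

end ClmForm

open ClmForm

/-! ### Derivability from global consequence. -/

theorem ax_mem_of_transValid {M : RuleSystem ClmForm} (hM : K4 ≤ M) {φ : ClmForm}
    (h : TransValid φ) : ax φ ∈ M.rules :=
  hM (RuleSystem.subset_generate _ ⟨φ, h, rfl⟩)

theorem derives_conj {M : RuleSystem ClmForm} (hM : K4 ≤ M) {Γ : Finset ClmForm}
    {l : List ClmForm} (h : ∀ φ ∈ l, (Γ, {φ}) ∈ M.rules) : (Γ, {conj l}) ∈ M.rules := by
  induction l with
  | nil => exact M.derives_ax (ax_mem_of_transValid hM fun _ _ _ _ _ => trivial)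
  | cons φ l ih =>
    refine M.derives_mp (φ := conj l) (M.derives_mp (φ := φ) (M.derives_ax
      (ax_mem_of_transValid hM ?_)) (h φ (by simp))) (ih fun ψ hψ => h ψ (by simp [hψ]))
    intro W R _ V x
    change Holds R V x (φ.imp ((conj l).imp (φ.and (conj l))))
    simp +contextual

/-- Global consequence over transitive models that satisfy finitely many theorems of `M` is
derivable in `M`. -/
theorem derives_of_global {M : RuleSystem ClmForm} (hM : K4 ≤ M) (Λ Γ : Finset ClmForm)
    (hΛ : ∀ ψ ∈ Λ, ax ψ ∈ M.rules) {φ : ClmForm}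
    (h : ∀ (W : Type) (R : W → W → Prop) (V : ℕ → Set W), (∀ x y z, R x y → R y z → R x z) →
      (∀ ψ ∈ Λ, ∀ x, Holds R V x ψ) → (∀ ψ ∈ Γ, ∀ x, Holds R V x ψ) → ∀ x, Holds R V x φ) :
    (Γ, {φ}) ∈ M.rules := by
  set θ := conj (Λ ∪ Γ).toList with hθ
  have hθM : (Γ, {θ}) ∈ M.rules := derives_conj hM fun ψ hψ => by
    rcases Finset.mem_union.1 (Finset.mem_toList.1 hψ) with hψ | hψ
    · exact M.derives_ax (hΛ ψ hψ)
    · exact M.mono (M.reflexivity ψ) (by simpa using hψ) subset_rfl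
  refine M.derives_mp (φ := θ) (M.derives_mp (φ := box θ) (M.derives_ax
    (ax_mem_of_transValid hM ?_)) (M.derives_box hθM)) hθM
  intro W R hR V x
  change Holds R V x ((box θ).imp (θ.imp φ))
  simp only [holds_imp]
  intro h₁ h₂
  -- In the submodel generated by `x`, the truth of `θ` and `□θ` at `x` becomes global truth of `Λ ∪
  -- Γ`, so the semantic hypothesis applies there.
  let p : W → Prop := fun y => x = y ∨ R x y
  have hp : ∀ y z, p y → R y z → p z := by
    rintro y z (rfl | hy) hz
    exacts [Or.inr hz, Or.inr (hR _ _ _ hy hz)]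
  have hθp : ∀ y : Subtype p, ∀ ψ ∈ Λ ∪ Γ, Holds R V y ψ := by
    rintro ⟨y, rfl | hy⟩ ψ hψ
    · exact holds_conj.1 h₂ ψ (Finset.mem_toList.2 hψ)
    · exact holds_conj.1 (h₁ y hy) ψ (Finset.mem_toList.2 hψ)
  refine (holds_restrict hp ⟨x, Or.inl rfl⟩).1 (h (Subtype p) _ _
    (fun a b c => hR a b c) (fun ψ hψ y => ?_) (fun ψ hψ y => ?_) _)
  · exact (holds_restrict hp y).2 (hθp y ψ (Finset.mem_union_left _ hψ))
  · exact (holds_restrict hp y).2 (hθp y ψ (Finset.mem_union_right _ hψ))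

/-- Formulae globally true in the same transitive models are interderivable. -/
theorem derives_of_global_imp {M : RuleSystem ClmForm} (hM : K4 ≤ M) {φ ψ : ClmForm}
    (h : ∀ (W : Type) (R : W → W → Prop) (V : ℕ → Set W), (∀ x y z, R x y → R y z → R x z) →
      (∀ x, Holds R V x φ) → ∀ x, Holds R V x ψ) : ({φ}, {ψ}) ∈ M.rules :=
  derives_of_global hM ∅ {φ} (by simp) fun W R V hR _ hφ => h W R V hR (hφ φ (by simp))

end ModalRules

/-! ### Superintuitionistic modal formulae on transitive frames. -/

namespace ModalRules

open ClmForm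

/-- `sat` interprets superintuitionistic modal formulae at the points of the transitive frame
`(W, R)`: implication is evaluated along the reflexive closure of `R` and `⊠` along `R`. -/
structure IsSimModel {W : Type} (R : W → W → Prop) (sat : W → SimForm → Prop) : Prop where
  trans : ∀ x y z, R x y → R y z → R x z
  persist : ∀ x y φ, R x y → sat x φ → sat y φ
  bot : ∀ x, ¬ sat x .bot
  top : ∀ x, sat x .top
  and : ∀ x φ ψ, sat x (.and φ ψ) ↔ sat x φ ∧ sat x ψ
  or : ∀ x φ ψ, sat x (.or φ ψ) ↔ sat x φ ∨ sat x ψ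
  imp : ∀ x φ ψ, sat x (.imp φ ψ) ↔ ∀ y, x = y ∨ R x y → sat y φ → sat y ψ
  box : ∀ x φ, sat x (.box φ) ↔ ∀ y, R x y → sat y φ

/-- Variables and implications are translated with `□⁺` in front, so every translation defines an
upset; the remaining clauses are those of `T`. -/
theorem isSimModel_translate {W : Type} {R : W → W → Prop} (V : ℕ → Set W)
    (hR : ∀ x y z, R x y → R y z → R x z) :
    IsSimModel R fun x φ => Holds R V x (translate φ) where
  trans := hR
  persist x y φ hxy := by
    have hup : ∀ ψ, Holds R V x (boxPlus ψ) → Holds R V y (boxPlus ψ) := fun ψ h =>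
      holds_boxPlus.2 fun z hz => holds_boxPlus.1 h z <| Or.inr <| by
        rcases hz with rfl | hz
        exacts [hxy, hR _ _ _ hxy hz]
    induction φ with
    | var n => exact hup _
    | bot => exact id
    | top => exact id
    | and φ ψ ih ih' => exact And.imp ih ih'
    | or φ ψ ih ih' => simpa only [translate, holds_or] using Or.imp ih ih'
    | imp φ ψ _ _ => exact hup _
    | box φ _ => exact fun h z hz => h z (hR _ _ _ hxy hz)
  bot _ := id
  top _ := trivial
  and _ _ _ := Iff.rfl
  or _ _ _ := holds_or
  imp x φ ψ := by
    simp only [translate, holds_boxPlus, holds_or, holds_neg, imp_iff_not_or]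
  box _ _ := Iff.rfl

namespace IsSimModel

variable {W : Type} {R : W → W → Prop} {sat : W → SimForm → Prop}

theorem persist' (h : IsSimModel R sat) {x y : W} {φ : SimForm} (hxy : x = y ∨ R x y)
    (hx : sat x φ) : sat y φ := by
  rcases hxy with rfl | hxy
  exacts [hx, h.persist x y φ hxy hx]

theorem rtrans (h : IsSimModel R sat) {x y z : W} (hxy : x = y ∨ R x y) (hyz : y = z ∨ R y z) :
    x = z ∨ R x z := by
  rcases hxy with rfl | hxy
  · exact hyz
  · rcases hyz with rfl | hyz
    exacts [Or.inr hxy, Or.inr (h.trans _ _ _ hxy hyz)]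

theorem sat_subst (h : IsSimModel R sat) {sat' : W → SimForm → Prop} (h' : IsSimModel R sat')
    {s : ℕ → SimForm} (hs : ∀ x n, sat' x (.var n) ↔ sat x (s n)) (x : W) (φ : SimForm) :
    sat' x φ ↔ sat x (φ.subst s) := by
  induction φ generalizing x with
  | var n => exact hs x n
  | bot => simp [SimForm.subst, h.bot, h'.bot]
  | top => simp [SimForm.subst, h.top, h'.top]
  | and φ ψ ih ih' => simp [SimForm.subst, h.and, h'.and, ih, ih']
  | or φ ψ ih ih' => simp [SimForm.subst, h.or, h'.or, ih, ih']
  | imp φ ψ ih ih' => simp [SimForm.subst, h.imp, h'.imp, ih, ih']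
  | box φ ih => simp [SimForm.subst, h.box, h'.box, ih]

theorem sat_of_ipc (h : IsSimModel R sat) {φ : IntForm} (hφ : IPC φ) (x : W) :
    sat x φ.toSim := by
  induction hφ generalizing x with
  | k φ ψ =>
    simp only [IntForm.toSim, h.imp]
    exact fun y _ hy z hz _ => h.persist' hz hy
  | s φ ψ χ =>
    simp only [IntForm.toSim, h.imp]
    exact fun y _ hy z hz hφψ w hw hφ => hy w (h.rtrans hz hw) hφ w (Or.inl rfl) (hφψ w hw hφ)
  | and_left φ ψ =>
    simp only [IntForm.toSim, h.imp, h.and]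
    exact fun y _ hy => hy.1
  | and_right φ ψ =>
    simp only [IntForm.toSim, h.imp, h.and]
    exact fun y _ hy => hy.2
  | and_intro φ ψ =>
    simp only [IntForm.toSim, h.imp, h.and]
    exact fun y _ hy z hz hz' => ⟨h.persist' hz hy, hz'⟩
  | or_left φ ψ =>
    simp only [IntForm.toSim, h.imp, h.or]
    exact fun y _ hy => Or.inl hy
  | or_right φ ψ =>
    simp only [IntForm.toSim, h.imp, h.or]
    exact fun y _ hy => Or.inr hy
  | or_elim φ ψ χ =>
    simp only [IntForm.toSim, h.imp, h.or]
    exact fun y _ hy z hz hz' w hw hor => hor.elim (hy w (h.rtrans hz hw)) (hz' w hw)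
  | ex_falso φ =>
    simp only [IntForm.toSim, h.imp]
    exact fun y _ hy => (h.bot y hy).elim
  | top_intro => exact h.top x
  | mp _ _ ih ih' => exact (h.imp _ _ _).1 (ih x) x (Or.inl rfl) (ih' x)

theorem sat_box_imp (h : IsSimModel R sat) (φ ψ : SimForm) (x : W) :
    sat x (.imp (.box (.imp φ ψ)) (.imp (.box φ) (.box ψ))) := by
  simp only [h.imp, h.box]
  intro y _ hy z hz hzφ w hzw
  have hyw : R y w := by
    rcases hz with rfl | hz
    exacts [hzw, h.trans _ _ _ hz hzw]
  exact hy w hyw w (Or.inl rfl) (hzφ w hzw)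

theorem sat_imp_box (h : IsSimModel R sat) (φ : SimForm) (x : W) :
    sat x (.imp φ (.box φ)) := by
  simp only [h.imp, h.box]
  exact fun y _ hy z hz => h.persist _ _ _ hz hy

/-- If `ψ` fails at `y`, a point of the reflexive closure above `y` where `ψ` holds differs from
`y`, hence is a genuine `R`-successor. -/
theorem sat_box_imp_or (h : IsSimModel R sat) (φ ψ : SimForm) (x : W) :
    sat x (.imp (.box φ) (.or ψ (.imp ψ φ))) := by
  simp only [h.imp, h.box, h.or, or_iff_not_imp_left]
  rintro y _ hy hyψ z hz hzψ
  by_cases hyz : y = z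
  · exact absurd (hyz ▸ hzψ) hyψ
  · exact hy z (hz hyz)

theorem sat_loeb (h : IsSimModel R sat) {φ : SimForm}
    (hloeb : ∀ x, (∀ y, R x y → (∀ z, R y z → sat z φ) → sat y φ) → ∀ y, R x y → sat y φ)
    (x : W) : sat x (.imp (.imp (.box φ) φ) φ) := by
  simp only [h.imp, h.box]
  intro y _ hy
  exact hy y (Or.inl rfl) (hloeb y fun z hz => hy z (Or.inr hz))

end IsSimModel

/-! ### Boolean combinations of truth sets. -/

namespace SimForm

def conj : List SimForm → SimForm
  | [] => top
  | φ :: l => and φ (conj l)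

def disj : List SimForm → SimForm
  | [] => bot
  | φ :: l => or φ (disj l)

/-- The formula saying that, at all points above the current one, the set of true elements of `Q`
satisfies `P`. -/
noncomputable def ofPred (Q : Finset SimForm) (P : Finset SimForm → Prop) : SimForm :=
  open Classical in
  conj ((Q.powerset.filter fun A => ¬ P A).toList.map fun A =>
    imp (conj A.toList) (disj (Q \ A).toList))

/-- A Boolean combination of `⊠`-formulae: a finite set of formulae, and a condition on its subset
of true members. -/
abbrev Combination : Type := Finset SimForm × (Finset SimForm → Prop)

open Classical in
/-- The truth value of a combination at a point where the formulae in `{φ | p φ}` are true. -/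
def Combination.Eval (c : Combination) (p : SimForm → Prop) : Prop := c.2 (c.1.filter p)

/-- The combination expressed by a classical formula whose variables are given by combinations. -/
noncomputable def combination (V : ℕ → Combination) : ClmForm → Combination
  | .var n => V n
  | .bot => (∅, fun _ => False)
  | .top => (∅, fun _ => True)
  | .and φ ψ => ((combination V φ).1 ∪ (combination V ψ).1, fun A =>
      (combination V φ).Eval (· ∈ A) ∧ (combination V ψ).Eval (· ∈ A))
  | .neg φ => ((combination V φ).1, fun A => ¬ (combination V φ).2 A)
  | .box φ => ({box (ofPred (combination V φ).1 (combination V φ).2)}, fun A =>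
      box (ofPred (combination V φ).1 (combination V φ).2) ∈ A)

end SimForm

open SimForm (Combination)

namespace IsSimModel

variable {W : Type} {R : W → W → Prop} {sat : W → SimForm → Prop}

theorem sat_conj (h : IsSimModel R sat) {x : W} {l : List SimForm} :
    sat x (SimForm.conj l) ↔ ∀ φ ∈ l, sat x φ := by
  induction l <;> simp_all [SimForm.conj, h.top, h.and]

theorem sat_disj (h : IsSimModel R sat) {x : W} {l : List SimForm} :
    sat x (SimForm.disj l) ↔ ∃ φ ∈ l, sat x φ := by
  induction l <;> simp_all [SimForm.disj, h.bot, h.or]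

/-- The implication from `⋀A` to `⋁(Q \ A)` forbids exactly the points where `A` is the set of true
members of `Q`. Without negation this can be stated only hereditarily, so the formula expresses `□⁺`
of the combination. -/
theorem sat_ofPred (h : IsSimModel R sat) {x : W} {c : Combination} :
    sat x (SimForm.ofPred c.1 c.2) ↔ ∀ y, x = y ∨ R x y → c.Eval (sat y) := by
  classical
  simp only [SimForm.ofPred, h.sat_conj, List.forall_mem_map, h.imp, Finset.mem_toList,
    Finset.mem_filter, Finset.mem_powerset, h.sat_disj, Finset.mem_sdiff, Combination.Eval]
  constructor
  · intro hx y hy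
    by_contra hP
    obtain ⟨φ, ⟨hφ, hφ'⟩, hyφ⟩ := hx (c.1.filter (sat y))
      ⟨Finset.filter_subset _ _, by convert hP⟩ y hy (by simp)
    exact hφ' (Finset.mem_filter.2 ⟨hφ, hyφ⟩)
  · rintro hx A ⟨hA, hP⟩ y hy hyA
    by_contra! hno
    refine hP ?_
    convert hx y hy
    ext φ
    rw [Finset.mem_filter]
    refine ⟨fun hφ => ⟨hA hφ, hyA φ hφ⟩, fun ⟨hφ, hyφ⟩ => ?_⟩
    by_contra hφA
    exact hno φ ⟨hφ, hφA⟩ hyφ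

/-- Closure of the combinations under `□`: by transitivity, `□` of a combination equals `⊠` of its
hereditary part, which is one superintuitionistic formula. -/
theorem holds_combination (h : IsSimModel R sat) (V : ℕ → Combination) (φ : ClmForm) (x : W) :
    Holds R (fun n => {y | (V n).Eval (sat y)}) x φ ↔
      (SimForm.combination V φ).Eval (sat x) := by
  classical
  induction φ generalizing x with
  | var n => exact Iff.rfl
  | bot => exact Iff.rfl
  | top => exact Iff.rfl
  | and φ ψ ih ih' =>
    rw [holds_and, ih, ih']
    simp only [SimForm.combination, Combination.Eval, Finset.mem_filter, Finset.mem_union]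
    refine Iff.of_eq (congrArg₂ And (congrArg _ ?_) (congrArg _ ?_)) <;> ext <;>
      simp +contextual
  | neg φ ih =>
    rw [holds_neg, ih]
    exact Iff.rfl
  | box φ ih =>
    simp only [holds_box, ih]
    rw [SimForm.combination, Combination.Eval]
    simp only [Finset.mem_filter, Finset.mem_singleton, true_and, h.box, h.sat_ofPred]
    refine ⟨fun hx y hy z hz => ?_, fun hx y hy => hx y hy y (Or.inl rfl)⟩
    rcases hz with rfl | hz
    exacts [hx y hy, hx z (h.trans _ _ _ hy hz)]

end IsSimModel

end ModalRules

namespace ModalRules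

open ClmForm
open SimForm (Combination)

/-! ### The systems `ρM`. -/

section Rho

variable {M : RuleSystem ClmForm}

theorem translateRule_ax (φ : SimForm) : translateRule (ax φ) = ax (translate φ) := by
  simp [translateRule, ax]

/-- `T` commutes with substitution only up to equivalence: `T(p)` becomes `□⁺T(s p)`, which
collapses to `T(s p)` because translations are persistent. -/
theorem global_translate_subst {W : Type} {R : W → W → Prop} (V : ℕ → Set W)
    (hR : ∀ x y z, R x y → R y z → R x z) (s : ℕ → SimForm) (φ : SimForm) (x : W) :
    Holds R V x ((translate φ).subst fun n => translate (s n)) ↔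
      Holds R V x (translate (φ.subst s)) := by
  have h := isSimModel_translate V hR
  rw [holds_subst]
  refine h.sat_subst (isSimModel_translate _ hR) (fun y n => ?_) x φ
  refine holds_boxPlus.trans ⟨fun hy => hy y (Or.inl rfl), fun hy z hz => h.persist' hz hy⟩

/-- `ρM` as a rule system. -/
def rhoSystem (hM : K4 ≤ M) : RuleSystem SimForm where
  rules := rho M
  structurality s Γ Δ h := by
    have h' := M.structurality (fun n => translate (s n)) _ _ h
    simp only [rho, translateRule, Set.mem_ofPred_eq, Finset.image_image] at h' ⊢
    refine M.image_of_derivable h' (fun φ _ => ?_) (fun φ _ => ?_) <;>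
      refine derives_of_global_imp hM fun W R V hR hφ x => ?_
    · exact (global_translate_subst V hR s φ x).2 (hφ x)
    · exact (global_translate_subst V hR s φ x).1 (hφ x)
  reflexivity φ := by
    simpa [rho, translateRule] using M.reflexivity (translate φ)
  monotonicity Γ Δ Γ' Δ' h := by
    simpa [rho, translateRule, Finset.image_union] using M.monotonicity _ _ _ _ h
  cut Γ Δ φ h h' := by
    simp only [rho, translateRule, Set.mem_ofPred_eq, Finset.image_insert] at h h' ⊢
    exact M.cut _ _ _ h h'
  modus_ponens φ ψ := by
    change translateRule ({φ, φ.imp ψ}, {ψ}) ∈ M.rules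
    simp only [translateRule, Finset.image_insert, Finset.image_singleton]
    refine derives_of_global hM ∅ _ (by simp) fun W R V hR _ h x => ?_
    exact ((isSimModel_translate V hR).imp x φ ψ).1 (h (translate (φ.imp ψ)) (by simp) x) x
      (Or.inl rfl) (h _ (by simp) x)
  necessitation φ := by
    change translateRule ({φ}, {φ.box}) ∈ M.rules
    simp only [translateRule, Finset.image_singleton]
    exact M.necessitation (translate φ)

theorem ax_loeb_mem (hM : GLSystem ≤ M) (φ : ClmForm) : ax (loeb φ) ∈ M.rules :=
  M.ax_subst (hM (RuleSystem.subset_adjoin _ _ rfl)) fun _ => φ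

theorem K4_le_GL : K4 ≤ GLSystem := RuleSystem.le_adjoin _ _

theorem KM_le_rhoSystem (hM : GLSystem ≤ M) : KMSystem ≤ rhoSystem (K4_le_GL.trans hM) := by
  have hK := K4_le_GL.trans hM
  have key : ∀ φ : SimForm, (∀ (W : Type) (R : W → W → Prop) (sat : W → SimForm → Prop),
      IsSimModel R sat → ∀ x, sat x φ) → ax φ ∈ rho M := fun φ h => by
    rw [rho, Set.mem_ofPred_eq, translateRule_ax]
    exact ax_mem_of_transValid hK fun W R hR V x => h W R _ (isSimModel_translate V hR) x
  refine RuleSystem.adjoin_le (RuleSystem.generate_le ?_) ?_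
  · rintro r (⟨φ, hφ, rfl⟩ | rfl | rfl | rfl)
    · exact key _ fun W R sat h => h.sat_of_ipc hφ
    · exact key _ fun W R sat h => h.sat_box_imp _ _
    · exact key _ fun W R sat h => h.sat_imp_box _
    · exact key _ fun W R sat h => h.sat_box_imp_or _ _
  · rintro r rfl
    change translateRule _ ∈ M.rules
    rw [translateRule_ax]
    refine derives_of_global hK {loeb (translate (.var 0))} _ (by
      simpa using ax_loeb_mem hM _) fun W R V hR h _ => ?_
    refine (isSimModel_translate V hR).sat_loeb fun x => ?_
    simpa [loeb] using h _ (Finset.mem_singleton_self _) x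

theorem K4Grz_le_GL : K4Grz ≤ GLSystem := by
  refine RuleSystem.adjoin_le K4_le_GL ?_
  rintro r rfl
  refine derives_of_global K4_le_GL {loeb (var 0)} _ (by
      simpa using ax_loeb_mem le_rfl _) fun W R V hR h _ x => ?_
  simp only [holds_imp, holds_box]
  intro hx y hxy
  by_contra hy
  obtain ⟨z, hxz, hz, hlast⟩ := exists_last (h _ (Finset.mem_singleton_self _) x) hxy hy
  -- At a last failure `z` of `p`, everything above `z` satisfies `p`, so `□(p → □p)` holds at `z`
  -- and the Grz premise forces `p` there.
  exact hz (hx z hxz fun w hw _ v hv => hlast v (hR _ _ _ hw hv))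

end Rho

/-! ### Types, last realizations, and recovering a system from its translated rules. -/

section Types

/-- Closure under immediate subformulae. -/
structure SubformulaClosed (Θ : Finset ClmForm) : Prop where
  and : ∀ φ ψ, ClmForm.and φ ψ ∈ Θ → φ ∈ Θ ∧ ψ ∈ Θ
  neg : ∀ φ, ClmForm.neg φ ∈ Θ → φ ∈ Θ
  box : ∀ φ, ClmForm.box φ ∈ Θ → φ ∈ Θ

theorem SubformulaClosed.union {Θ Θ' : Finset ClmForm} (h : SubformulaClosed Θ)
    (h' : SubformulaClosed Θ') : SubformulaClosed (Θ ∪ Θ') := by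
  constructor
  · intro φ ψ hφ
    have := h.and φ ψ
    have := h'.and φ ψ
    simp only [Finset.mem_union] at hφ ⊢
    tauto
  · intro φ hφ
    exact Finset.mem_union.2 ((Finset.mem_union.1 hφ).imp (h.neg φ) (h'.neg φ))
  · intro φ hφ
    exact Finset.mem_union.2 ((Finset.mem_union.1 hφ).imp (h.box φ) (h'.box φ))

theorem exists_subformulaClosed_mem (φ : ClmForm) : ∃ Θ, SubformulaClosed Θ ∧ φ ∈ Θ := by
  induction φ with
  | var n => exact ⟨{var n}, by constructor <;> simp, by simp⟩
  | bot => exact ⟨{bot}, by constructor <;> simp, by simp⟩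
  | top => exact ⟨{top}, by constructor <;> simp, by simp⟩
  | and φ ψ ih ih' =>
    obtain ⟨Θ, hΘ, hφ⟩ := ih
    obtain ⟨Θ', hΘ', hψ⟩ := ih'
    have h := hΘ.union hΘ'
    refine ⟨insert (and φ ψ) (Θ ∪ Θ'), ⟨fun χ χ' hχ => ?_, fun χ hχ => ?_, fun χ hχ => ?_⟩,
      by simp⟩ <;> rw [Finset.mem_insert] at hχ
    · rcases hχ with hχ | hχ
      · cases hχ; simp [hφ, hψ]
      · exact (h.and _ _ hχ).imp Finset.mem_insert_of_mem Finset.mem_insert_of_mem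
    · exact Finset.mem_insert_of_mem (h.neg _ (hχ.resolve_left (by simp)))
    · exact Finset.mem_insert_of_mem (h.box _ (hχ.resolve_left (by simp)))
  | neg φ ih =>
    obtain ⟨Θ, h, hφ⟩ := ih
    refine ⟨insert (neg φ) Θ, ⟨fun χ χ' hχ => ?_, fun χ hχ => ?_, fun χ hχ => ?_⟩,
      by simp⟩ <;> rw [Finset.mem_insert] at hχ
    · exact (h.and _ _ (hχ.resolve_left (by simp))).imp Finset.mem_insert_of_mem
        Finset.mem_insert_of_mem
    · rcases hχ with hχ | hχ
      · cases hχ; simp [hφ]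
      · exact Finset.mem_insert_of_mem (h.neg _ hχ)
    · exact Finset.mem_insert_of_mem (h.box _ (hχ.resolve_left (by simp)))
  | box φ ih =>
    obtain ⟨Θ, h, hφ⟩ := ih
    refine ⟨insert (box φ) Θ, ⟨fun χ χ' hχ => ?_, fun χ hχ => ?_, fun χ hχ => ?_⟩,
      by simp⟩ <;> rw [Finset.mem_insert] at hχ
    · exact (h.and _ _ (hχ.resolve_left (by simp))).imp Finset.mem_insert_of_mem
        Finset.mem_insert_of_mem
    · exact Finset.mem_insert_of_mem (h.neg _ (hχ.resolve_left (by simp)))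
    · rcases hχ with hχ | hχ
      · cases hχ; simp [hφ]
      · exact Finset.mem_insert_of_mem (h.box _ hχ)

theorem exists_subformulaClosed (Γ : Finset ClmForm) : ∃ Θ, SubformulaClosed Θ ∧ Γ ⊆ Θ := by
  induction Γ using Finset.induction_on with
  | empty => exact ⟨∅, by constructor <;> simp, by simp⟩
  | insert φ Γ _ ih =>
    obtain ⟨Θ, hΘ, hΓ⟩ := ih
    obtain ⟨Θ', hΘ', hφ⟩ := exists_subformulaClosed_mem φ
    exact ⟨Θ' ∪ Θ, hΘ'.union hΘ, Finset.insert_subset (Finset.mem_union_left _ hφ)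
      (hΓ.trans Finset.subset_union_right)⟩

open Classical in
/-- The members of `Θ` true at a point. -/
noncomputable def typeAt {W : Type} (R : W → W → Prop) (V : ℕ → Set W) (Θ : Finset ClmForm)
    (x : W) : Finset ClmForm := Θ.filter fun φ => Holds R V x φ

theorem mem_typeAt {W : Type} {R : W → W → Prop} {V : ℕ → Set W} {Θ : Finset ClmForm}
    {x : W} {φ : ClmForm} : φ ∈ typeAt R V Θ x ↔ φ ∈ Θ ∧ Holds R V x φ := by
  simp [typeAt]

/-- A selection of types above each point that is exact at the last points of each type. -/
structure IsTypeSelection {W : Type} (R : W → W → Prop) (V : ℕ → Set W) (Θ : Finset ClmForm)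
    (G : W → Finset ClmForm) : Prop where
  exists_last : ∀ x, ∃ y, (x = y ∨ R x y) ∧ typeAt R V Θ y = typeAt R V Θ x ∧
    ∀ z, R y z → typeAt R V Θ z ≠ typeAt R V Θ y
  of_last : ∀ x, (∀ z, R x z → typeAt R V Θ z ≠ typeAt R V Θ x) → G x = typeAt R V Θ x
  above : ∀ x, ∃ y, (x = y ∨ R x y) ∧ G x = typeAt R V Θ y
  box : ∀ x φ, ClmForm.box φ ∈ Θ → (ClmForm.box φ ∈ G x ↔ Holds R V x (ClmForm.box φ))

namespace IsTypeSelection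

variable {W : Type} {R : W → W → Prop} {V : ℕ → Set W} {Θ : Finset ClmForm}
  {G : W → Finset ClmForm}

theorem exists_eq (h : IsTypeSelection R V Θ G) (x : W) :
    ∃ y, (x = y ∨ R x y) ∧ G y = typeAt R V Θ x := by
  obtain ⟨y, hxy, hy, hlast⟩ := h.exists_last x
  exact ⟨y, hxy, (h.of_last y hlast).trans hy⟩

/-- Each `G x` is the type of some point, which settles the Boolean cases. For boxes, the original
types and the values of `G` occurring strictly above a point are the same, by `exists_eq` and
`above`. -/
theorem holds_iff (h : IsTypeSelection R V Θ G) (hR : ∀ x y z, R x y → R y z → R x z)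
    (hΘ : SubformulaClosed Θ) {φ : ClmForm} (hφ : φ ∈ Θ) (x : W) :
    Holds R (fun n => {y | var n ∈ G y}) x φ ↔ φ ∈ G x := by
  induction φ generalizing x with
  | var n => exact Iff.rfl
  | bot =>
    obtain ⟨y, -, hy⟩ := h.above x
    simp [hy, mem_typeAt]
  | top =>
    obtain ⟨y, -, hy⟩ := h.above x
    simp [hy, mem_typeAt, hφ]
  | and φ ψ ih ih' =>
    obtain ⟨y, -, hy⟩ := h.above x
    have hs := hΘ.and _ _ hφ
    simp [ih hs.1, ih' hs.2, hy, mem_typeAt, hφ, hs]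
  | neg φ ih =>
    obtain ⟨y, -, hy⟩ := h.above x
    have hs := hΘ.neg _ hφ
    simp [ih hs, hy, mem_typeAt, hφ, hs]
  | box φ ih =>
    have hs := hΘ.box _ hφ
    rw [h.box x φ hφ]
    simp only [holds_box, ih hs]
    constructor
    · intro hx y hy
      obtain ⟨z, hz, hGz⟩ := h.exists_eq y
      have hxz : R x z := by
        rcases hz with rfl | hz
        exacts [hy, hR _ _ _ hy hz]
      exact (mem_typeAt.1 (hGz ▸ hx z hxz)).2
    · intro hx y hy
      obtain ⟨z, hz, hGz⟩ := h.above y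
      have hxz : R x z := by
        rcases hz with rfl | hz
        exacts [hy, hR _ _ _ hy hz]
      exact hGz ▸ mem_typeAt.2 ⟨hs, hx z hxz⟩

theorem global_iff (h : IsTypeSelection R V Θ G) (hR : ∀ x y z, R x y → R y z → R x z)
    (hΘ : SubformulaClosed Θ) {φ : ClmForm} (hφ : φ ∈ Θ) :
    (∀ x, Holds R (fun n => {y | var n ∈ G y}) x φ) ↔ ∀ x, Holds R V x φ := by
  simp only [h.holds_iff hR hΘ hφ]
  constructor
  · intro hx x
    obtain ⟨y, -, hy⟩ := h.exists_eq x
    exact (mem_typeAt.1 (hy ▸ hx y)).2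
  · intro hx x
    obtain ⟨y, -, hy⟩ := h.above x
    exact hy ▸ mem_typeAt.2 ⟨hφ, hx y⟩

end IsTypeSelection

/-- The type `S` is realized last at a point, where `A` is the set of formulae among `q_S`, `⊠q_S`
true there. -/
def LastType (enc : Finset ClmForm → ℕ) (A : Finset SimForm) (S : Finset ClmForm) : Prop :=
  SimForm.box (.var (enc S)) ∈ A ∧ SimForm.var (enc S) ∉ A

/-- The type `S` is realized strictly above a point and agrees with it on boxed formulae. -/
def AboveType (Θ : Finset ClmForm) (enc : Finset ClmForm → ℕ) (A : Finset SimForm)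
    (S : Finset ClmForm) : Prop :=
  SimForm.box (.var (enc S)) ∉ A ∧ ∀ φ, box φ ∈ Θ →
    (box φ ∈ S ↔ ∀ S' ∈ Θ.powerset, φ ∉ S' → SimForm.box (.var (enc S')) ∈ A)

-- The choice depends only on `A`, so membership in the selected type is a Boolean combination of
-- the `q_S` and `⊠q_S`. The default `∅` is never reached in the models considered below.
open Classical in
noncomputable def selectType (Θ : Finset ClmForm) (enc : Finset ClmForm → ℕ)
    (A : Finset SimForm) : Finset ClmForm :=
  if h : ∃ S ∈ Θ.powerset, LastType enc A S then h.choose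
  else if h : ∃ S ∈ Θ.powerset, AboveType Θ enc A S then h.choose else ∅

/-- The formulae `q_S` and `⊠q_S` for `S ⊆ Θ`. -/
def typeVars (Θ : Finset ClmForm) (enc : Finset ClmForm → ℕ) : Finset SimForm :=
  Θ.powerset.image (fun S => .var (enc S)) ∪ Θ.powerset.image fun S => .box (.var (enc S))

/-- The formula saying that exactly the members of `S` are true among those of `Θ`. -/
noncomputable def typeFormula (Θ S : Finset ClmForm) : ClmForm := ofPred Θ id (· = S)

theorem holds_typeFormula {W : Type} {R : W → W → Prop} {V : ℕ → Set W}
    {Θ S : Finset ClmForm} {x : W} :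
    Holds R V x (typeFormula Θ S) ↔ typeAt R V Θ x = S := holds_ofPred

-- At a last point the only candidate is the point's own type, so the selection is exact. Elsewhere
-- no type is last there, and the selected type occurs strictly above with the correct boxed
-- members. Löb supplies the last points.
open Classical in
theorem isTypeSelection_selectType {W : Type} {R : W → W → Prop} {V : ℕ → Set W}
    {Θ : Finset ClmForm} {enc : Finset ClmForm → ℕ} {sat : W → SimForm → Prop}
    (hsat : IsSimModel R sat) (hΘ : SubformulaClosed Θ)
    (hvar : ∀ S ∈ Θ.powerset, ∀ x, sat x (.var (enc S)) ↔
      ∀ y, x = y ∨ R x y → typeAt R V Θ y ≠ S)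
    (hloeb : ∀ S ∈ Θ.powerset, ∀ x, Holds R V x (loeb (neg (typeFormula Θ S)))) :
    IsTypeSelection R V Θ fun x => selectType Θ enc ((typeVars Θ enc).filter (sat x)) := by
  have hmem : ∀ x, typeAt R V Θ x ∈ Θ.powerset := fun x =>
    Finset.mem_powerset.2 (Finset.filter_subset _ _)
  have hv : ∀ x, ∀ S ∈ Θ.powerset, SimForm.var (enc S) ∈ (typeVars Θ enc).filter (sat x) ↔
      ∀ y, x = y ∨ R x y → typeAt R V Θ y ≠ S := fun x S hS => by
    rw [Finset.mem_filter, hvar S hS, and_iff_right]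
    exact Finset.mem_union_left _ (Finset.mem_image_of_mem _ hS)
  have hb : ∀ x, ∀ S ∈ Θ.powerset,
      SimForm.box (.var (enc S)) ∈ (typeVars Θ enc).filter (sat x) ↔
      ∀ y, R x y → typeAt R V Θ y ≠ S := fun x S hS => by
    rw [Finset.mem_filter, hsat.box, and_iff_right]
    · simp only [hvar S hS]
      refine ⟨fun h y hy => h y hy y (Or.inl rfl), fun h y hy z hz => ?_⟩
      rcases hz with rfl | hz
      exacts [h y hy, h z (hsat.trans _ _ _ hy hz)]
    · exact Finset.mem_union_right _ (Finset.mem_image_of_mem _ hS)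
  have hlast : ∀ x, ∀ S ∈ Θ.powerset, LastType enc ((typeVars Θ enc).filter (sat x)) S ↔
      typeAt R V Θ x = S ∧ ∀ y, R x y → typeAt R V Θ y ≠ S := fun x S hS => by
    rw [LastType, hv x S hS, hb x S hS, and_comm]
    refine and_congr_left fun h => ?_
    by_contra! hcon
    rcases hcon with ⟨h₁, h₂⟩ | ⟨h₁, h₂⟩
    · obtain ⟨y, rfl | hy, hyS⟩ := h₁
      exacts [h₂ hyS, h y hy hyS]
    · exact h₁ x (Or.inl rfl) h₂
  have habove : ∀ x, ∀ S ∈ Θ.powerset, AboveType Θ enc ((typeVars Θ enc).filter (sat x)) S ↔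
      (∃ y, R x y ∧ typeAt R V Θ y = S) ∧
        ∀ φ, box φ ∈ Θ → (box φ ∈ S ↔ Holds R V x (box φ)) := fun x S hS => by
    rw [AboveType, hb x S hS]
    refine and_congr (by push Not; rfl) (forall₂_congr fun φ hφ => ?_)
    -- The condition says that no type omitting `φ` occurs strictly above `x`, which is `□φ` at `x`.
    refine iff_congr Iff.rfl ⟨fun h y hy => ?_, fun h S' hS' hφ' => ?_⟩
    · by_contra hyφ
      exact (hb x _ (hmem y)).1 (h _ (hmem y) fun hm => hyφ (mem_typeAt.1 hm).2) y hy rfl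
    · refine (hb x _ hS').2 fun y hy hyS => hφ' ?_
      rw [← hyS]
      exact mem_typeAt.2 ⟨hΘ.box _ hφ, h y hy⟩
  have hcase : ∀ x, selectType Θ enc ((typeVars Θ enc).filter (sat x)) = typeAt R V Θ x ∨
      (¬ ∀ z, R x z → typeAt R V Θ z ≠ typeAt R V Θ x) ∧
      (∃ y, R x y ∧ typeAt R V Θ y = selectType Θ enc ((typeVars Θ enc).filter (sat x))) ∧
        ∀ φ, box φ ∈ Θ → (box φ ∈ selectType Θ enc ((typeVars Θ enc).filter (sat x)) ↔
          Holds R V x (box φ)) := fun x => by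
    by_cases h : ∃ S ∈ Θ.powerset, LastType enc ((typeVars Θ enc).filter (sat x)) S
    · left
      rw [selectType, dif_pos h]
      exact ((hlast x _ h.choose_spec.1).1 h.choose_spec.2).1.symm
    · right
      have hx : ¬ ∀ z, R x z → typeAt R V Θ z ≠ typeAt R V Θ x := fun hx =>
        h ⟨_, hmem x, (hlast x _ (hmem x)).2 ⟨rfl, hx⟩⟩
      refine ⟨hx, ?_⟩
      -- The type of `x` itself qualifies: it recurs strictly above, and its boxed members are those
      -- true at `x`.
      have h' : ∃ S ∈ Θ.powerset, AboveType Θ enc ((typeVars Θ enc).filter (sat x)) S := by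
        push Not at hx
        refine ⟨_, hmem x, (habove x _ (hmem x)).2 ⟨hx, fun φ hφ => ?_⟩⟩
        simp [mem_typeAt, hφ]
      rw [selectType, dif_neg h, dif_pos h']
      exact (habove x _ h'.choose_spec.1).1 h'.choose_spec.2
  refine ⟨fun x => ?_, fun x hx => ?_, fun x => ?_, fun x φ hφ => ?_⟩
  · by_cases hx : ∀ z, R x z → typeAt R V Θ z ≠ typeAt R V Θ x
    · exact ⟨x, Or.inl rfl, rfl, hx⟩
    · push Not at hx
      obtain ⟨y, hxy, hy⟩ := hx
      -- Failures of `¬(type = S)` are realizations of `S`, so its last failure is a last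
      -- realization.
      obtain ⟨z, hxz, hz, hlastz⟩ := exists_last (hloeb _ (hmem x) x) hxy
        (by simpa [holds_typeFormula] using hy)
      simp only [holds_neg, holds_typeFormula, not_not] at hz hlastz
      exact ⟨z, Or.inr hxz, hz, hz ▸ hlastz⟩
  · exact (hcase x).resolve_right fun h => h.1 hx
  · rcases hcase x with h | ⟨-, ⟨y, hy, h⟩, -⟩
    exacts [⟨x, Or.inl rfl, h⟩, ⟨y, Or.inr hy, h.symm⟩]
  · rcases hcase x with h | ⟨-, -, h⟩
    · simp [h, mem_typeAt, hφ]
    · exact h φ hφ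

end Types

/-- A system above `GL` is determined by the translations it contains. -/
theorem le_of_rho_subset {M N : RuleSystem ClmForm} (hM : GLSystem ≤ M) (hN : GLSystem ≤ N)
    (h : rho M ⊆ rho N) : M ≤ N := by
  classical
  rintro ⟨Γ, Δ⟩ hr
  obtain ⟨Θ, hΘ, hΓΔ⟩ := exists_subformulaClosed (Γ ∪ Δ)
  obtain ⟨enc, henc⟩ :=
    Set.countable_iff_exists_injOn.1 (Finset.countable_toSet Θ.powerset)
  set dec := Function.invFunOn enc (Θ.powerset : Set (Finset ClmForm))
  have hdec : ∀ S ∈ Θ.powerset, dec (enc S) = S := fun S hS => henc.leftInvOn_invFunOn hS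
  -- `c` and `s` replace each variable by its membership in the selected type, `u` reads `q_S` as
  -- the absence of type `S`, and `star φ` is the superintuitionistic formula whose translation is
  -- globally equivalent to `s φ`.
  let c : ℕ → Combination := fun n => (typeVars Θ enc, fun A => var n ∈ selectType Θ enc A)
  let s : ℕ → ClmForm := fun n => ofPred (c n).1 translate (c n).2
  let u : ℕ → ClmForm := fun n => neg (typeFormula Θ (dec n))
  let star : ClmForm → SimForm := fun φ =>
    SimForm.ofPred (SimForm.combination c φ).1 (SimForm.combination c φ).2
  have hs : ∀ {W : Type} {R : W → W → Prop} {V : ℕ → Set W},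
      (fun n => {y | Holds R V y (s n)}) =
        fun n => {y | (c n).Eval fun φ => Holds R V y (translate φ)} := fun {W R V} => by
    funext n
    ext y
    exact holds_ofPred
  have hstar : ∀ (W : Type) (R : W → W → Prop) (V : ℕ → Set W),
      (∀ x y z, R x y → R y z → R x z) → ∀ φ,
      (∀ x, Holds R V x (φ.subst s)) ↔ ∀ x, Holds R V x (translate (star φ)) := by
    intro W R V hR φ
    have hsat := isSimModel_translate V hR
    simp only [holds_subst, hs, hsat.holds_combination]
    refine ⟨fun h x => hsat.sat_ofPred.2 fun y _ => h y, fun h x =>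
      hsat.sat_ofPred.1 (h x) x (Or.inl rfl)⟩
  have h₁ : (Γ.image (translate ∘ star), Δ.image (translate ∘ star)) ∈ M.rules := by
    refine M.image_of_derivable (M.structurality s _ _ hr) (fun φ _ => ?_) (fun φ _ => ?_) <;>
      refine derives_of_global_imp (K4_le_GL.trans hM) fun W R V hR => ?_
    exacts [(hstar W R V hR φ).2, (hstar W R V hR φ).1]
  have h₂ : (Γ.image (translate ∘ star), Δ.image (translate ∘ star)) ∈ N.rules := by
    have : (Γ.image star, Δ.image star) ∈ rho M := by
      simpa [rho, translateRule, Finset.image_image] using h₁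
    simpa [rho, translateRule, Finset.image_image] using h this
  have h₃ : (Γ.image (subst s), Δ.image (subst s)) ∈ N.rules := by
    refine N.image_of_derivable h₂ (fun φ _ => ?_) (fun φ _ => ?_) <;>
      refine derives_of_global_imp (K4_le_GL.trans hN) fun W R V hR => ?_
    exacts [(hstar W R V hR φ).1, (hstar W R V hR φ).2]
  -- It remains to undo `u ∘ s`: on models of finitely many Löb instances it preserves global truth
  -- of members of `Θ`.
  have h₄ := N.structurality u _ _ h₃
  simp only [Finset.image_image] at h₄
  have hus : ∀ φ ∈ Θ, ∀ (W : Type) (R : W → W → Prop) (V : ℕ → Set W),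
      (∀ x y z, R x y → R y z → R x z) →
      (∀ ψ ∈ Θ.powerset.image fun S => loeb (neg (typeFormula Θ S)), ∀ x, Holds R V x ψ) →
      ((∀ x, Holds R V x (subst u (subst s φ))) ↔ ∀ x, Holds R V x φ) := by
    intro φ hφ W R V hR hloeb
    -- Under the valuation given by `u`, `T(q_S)` holds exactly where `S` occurs neither here nor
    -- above, as the type selection requires.
    have hsat := isSimModel_translate (fun n => {y | Holds R V y (u n)}) hR
    have hsel := isTypeSelection_selectType (V := V) (enc := enc) hsat hΘ (fun S hS x => by
      refine holds_boxPlus.trans (forall₂_congr fun y _ => ?_)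
      change Holds R V y (u (enc S)) ↔ _
      simp only [u, holds_neg, holds_typeFormula, hdec S hS, ne_eq])
      (by simpa only [Finset.forall_mem_image] using hloeb)
    rw [← hsel.global_iff hR hΘ hφ]
    simp only [holds_subst (s := u), holds_subst (s := s), hs]
    exact Iff.rfl
  have hΛ : ∀ ψ ∈ Θ.powerset.image fun S => loeb (neg (typeFormula Θ S)), ax ψ ∈ N.rules := by
    simpa only [Finset.forall_mem_image] using fun S _ => ax_loeb_mem hN _
  have h₅ := N.image_of_derivable (g := id) h₄ (fun φ hφ => ?_) (fun φ hφ => ?_)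
  · simpa using h₅
  · refine derives_of_global (K4_le_GL.trans hN) _ _ hΛ fun W R V hR hl hΓ => ?_
    exact (hus φ (hΓΔ (Finset.mem_union_left _ hφ)) W R V hR hl).2 (hΓ φ (by simp))
  · refine derives_of_global (K4_le_GL.trans hN) _ _ hΛ fun W R V hR hl hΓ => ?_
    exact (hus φ (hΓΔ (Finset.mem_union_right _ hφ)) W R V hR hl).1 (hΓ _ (Finset.mem_singleton_self _))

end ModalRules

namespace ModalRules

open ClmForm
open SimForm (Combination)

/-! ### Canonical models of saturated sets -/

/-- Sets of formulae containing `X` and closed under modus ponens. -/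
structure IsTheory (X x : Set SimForm) : Prop where
  subset : X ⊆ x
  mp : ∀ φ ψ, SimForm.imp φ ψ ∈ x → φ ∈ x → ψ ∈ x

/-- Prime theories. -/
structure IsPrimeTheory (X x : Set SimForm) : Prop extends IsTheory X x where
  bot : SimForm.bot ∉ x
  prime : ∀ φ ψ, SimForm.or φ ψ ∈ x → φ ∈ x ∨ ψ ∈ x

/-- Sets closed under the axioms and rules of the modalized Heyting calculus. -/
structure IsMHCTheory (X : Set SimForm) : Prop where
  mp : ∀ φ ψ, SimForm.imp φ ψ ∈ X → φ ∈ X → ψ ∈ X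
  nec : ∀ φ, φ ∈ X → SimForm.box φ ∈ X
  ipc : ∀ (s : ℕ → SimForm) φ, IPC φ → φ.toSim.subst s ∈ X
  box_imp : ∀ φ ψ : SimForm, (((φ.imp ψ).box).imp (φ.box.imp ψ.box)) ∈ X
  imp_box : ∀ φ : SimForm, φ.imp φ.box ∈ X
  box_imp_or : ∀ φ ψ : SimForm, φ.box.imp (ψ.or (ψ.imp φ)) ∈ X

namespace IsMHCTheory

variable {X : Set SimForm}

theorem k (h : IsMHCTheory X) (φ ψ : SimForm) : φ.imp (ψ.imp φ) ∈ X :=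
  h.ipc (fun n => if n = 0 then φ else ψ) _ (IPC.k (.var 0) (.var 1))

theorem s (h : IsMHCTheory X) (φ ψ χ : SimForm) :
    (φ.imp (ψ.imp χ)).imp ((φ.imp ψ).imp (φ.imp χ)) ∈ X :=
  h.ipc (fun n => if n = 0 then φ else if n = 1 then ψ else χ) _
    (IPC.s (.var 0) (.var 1) (.var 2))

theorem and_left (h : IsMHCTheory X) (φ ψ : SimForm) : (φ.and ψ).imp φ ∈ X :=
  h.ipc (fun n => if n = 0 then φ else ψ) _ (IPC.and_left (.var 0) (.var 1))

theorem and_right (h : IsMHCTheory X) (φ ψ : SimForm) : (φ.and ψ).imp ψ ∈ X :=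
  h.ipc (fun n => if n = 0 then φ else ψ) _ (IPC.and_right (.var 0) (.var 1))

theorem and_intro (h : IsMHCTheory X) (φ ψ : SimForm) : φ.imp (ψ.imp (φ.and ψ)) ∈ X :=
  h.ipc (fun n => if n = 0 then φ else ψ) _ (IPC.and_intro (.var 0) (.var 1))

theorem or_left (h : IsMHCTheory X) (φ ψ : SimForm) : φ.imp (φ.or ψ) ∈ X :=
  h.ipc (fun n => if n = 0 then φ else ψ) _ (IPC.or_left (.var 0) (.var 1))

theorem or_right (h : IsMHCTheory X) (φ ψ : SimForm) : ψ.imp (φ.or ψ) ∈ X :=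
  h.ipc (fun n => if n = 0 then φ else ψ) _ (IPC.or_right (.var 0) (.var 1))

theorem or_elim (h : IsMHCTheory X) (φ ψ χ : SimForm) :
    (φ.imp χ).imp ((ψ.imp χ).imp ((φ.or ψ).imp χ)) ∈ X :=
  h.ipc (fun n => if n = 0 then φ else if n = 1 then ψ else χ) _
    (IPC.or_elim (.var 0) (.var 1) (.var 2))

theorem top (h : IsMHCTheory X) : SimForm.top ∈ X := h.ipc .var _ IPC.top_intro

theorem imp_self (h : IsMHCTheory X) (φ : SimForm) : φ.imp φ ∈ X :=
  h.mp _ _ (h.mp _ _ (h.s φ (φ.imp φ) φ) (h.k _ _)) (h.k _ _)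

theorem isTheory_self (h : IsMHCTheory X) : IsTheory X X := ⟨subset_rfl, h.mp⟩

/-- The theory generated by `x` and `φ`, described by the deduction theorem. -/
theorem isTheory_imp (h : IsMHCTheory X) {x : Set SimForm} (hx : IsTheory X x) (φ : SimForm) :
    IsTheory X {ψ | φ.imp ψ ∈ x} where
  subset ψ hψ := hx.subset (h.mp _ _ (h.k ψ φ) hψ)
  mp ψ χ h₁ h₂ := hx.mp _ _ (hx.mp _ _ (hx.subset (h.s φ ψ χ)) h₁) h₂

theorem isTheory_box (h : IsMHCTheory X) {x : Set SimForm} (hx : IsTheory X x) :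
    IsTheory X {ψ | ψ.box ∈ x} where
  subset ψ hψ := hx.subset (h.nec ψ hψ)
  mp ψ χ h₁ h₂ := hx.mp _ _ (hx.mp _ _ (hx.subset (h.box_imp ψ χ)) h₁) h₂

theorem subset_imp (h : IsMHCTheory X) {x : Set SimForm} (hx : IsTheory X x) (φ : SimForm) :
    x ⊆ {ψ | φ.imp ψ ∈ x} :=
  fun ψ hψ => hx.mp _ _ (hx.subset (h.k ψ φ)) hψ

/-- A theory maximal among those omitting `χ` is prime: it contains `φ → χ` for every `φ` outside
it, so omitting both disjuncts of a member would put `χ` in. -/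
theorem exists_prime (h : IsMHCTheory X) {x : Set SimForm} (hx : IsTheory X x) {χ : SimForm}
    (hχ : χ ∉ x) : ∃ y, IsPrimeTheory X y ∧ x ⊆ y ∧ χ ∉ y := by
  obtain ⟨y, hxy, hy⟩ := zorn_subset_nonempty {y | IsTheory X y ∧ χ ∉ y} (by
    intro c hc hchain hne
    refine ⟨⋃₀ c, ⟨⟨?_, ?_⟩, ?_⟩, fun s hs => Set.subset_sUnion_of_mem hs⟩
    · obtain ⟨y, hy⟩ := hne
      exact (hc hy).1.subset.trans (Set.subset_sUnion_of_mem hy)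
    · rintro φ ψ ⟨y, hy, h₁⟩ ⟨z, hz, h₂⟩
      rcases hchain.total hy hz with hyz | hyz
      exacts [⟨z, hz, (hc hz).1.mp _ _ (hyz h₁) h₂⟩, ⟨y, hy, (hc hy).1.mp _ _ h₁ (hyz h₂)⟩]
    · rintro ⟨y, hy, h₁⟩
      exact (hc hy).2 h₁) x ⟨hx, hχ⟩
  have hyT := hy.1.1
  have key : ∀ φ, φ ∉ y → φ.imp χ ∈ y := fun φ hφ => by
    by_contra hcon
    exact hφ (hy.2 (y := {ψ | φ.imp ψ ∈ y}) ⟨h.isTheory_imp hyT φ, hcon⟩ (h.subset_imp hyT φ)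
      (hyT.subset (h.imp_self φ)))
  refine ⟨y, ⟨hyT, fun hbot => hy.1.2 (hyT.mp _ _ (hyT.subset ?_) hbot), fun φ ψ hor => ?_⟩,
    hxy, hy.1.2⟩
  · exact h.ipc (fun _ => χ) _ (IPC.ex_falso (.var 0))
  · by_contra! hcon
    exact hy.1.2 (hyT.mp _ _ (hyT.mp _ _ (hyT.mp _ _ (hyT.subset (h.or_elim φ ψ χ))
      (key φ hcon.1)) (key ψ hcon.2)) hor)

end IsMHCTheory

/-- The canonical frame of `X`. -/
def CanonicalWorld (X : Set SimForm) : Type := {x : Set SimForm // IsPrimeTheory X x}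

def canonicalRel (X : Set SimForm) (x y : CanonicalWorld X) : Prop :=
  ∀ φ : SimForm, φ.box ∈ x.1 → φ ∈ y.1

/-- The delicate clause is implication, usually tested along inclusion but here along the reflexive
closure of the canonical relation. The axiom `⊠p → (q ∨ (q → p))` bridges the two. -/
theorem isSimModel_canonical {X : Set SimForm} (h : IsMHCTheory X) :
    IsSimModel (canonicalRel X) fun x φ => φ ∈ x.1 := by
  have hpers : ∀ x y φ, canonicalRel X x y → φ ∈ x.1 → φ ∈ y.1 := fun x y φ hxy hφ =>
    hxy φ (x.2.mp _ _ (x.2.subset (h.imp_box φ)) hφ)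
  refine ⟨fun x y z hxy hyz φ hφ => ?_, hpers, fun x => x.2.bot, fun x => x.2.subset h.top,
    fun x φ ψ => ⟨fun hx => ⟨?_, ?_⟩, fun hx => ?_⟩,
    fun x φ ψ => ⟨x.2.prime φ ψ, fun hx => hx.elim ?_ ?_⟩,
    fun x φ ψ => ⟨fun hx y hy hφ => ?_, fun hx => ?_⟩,
    fun x φ => ⟨fun hx y hy => hy φ hx, fun hx => ?_⟩⟩
  · exact hpers y z φ hyz (hxy φ hφ)
  · exact x.2.mp _ _ (x.2.subset (h.and_left φ ψ)) hx
  · exact x.2.mp _ _ (x.2.subset (h.and_right φ ψ)) hx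
  · exact x.2.mp _ _ (x.2.mp _ _ (x.2.subset (h.and_intro φ ψ)) hx.1) hx.2
  · exact x.2.mp _ _ (x.2.subset (h.or_left φ ψ))
  · exact x.2.mp _ _ (x.2.subset (h.or_right φ ψ))
  · rcases hy with rfl | hy
    exacts [x.2.mp _ _ hx hφ, y.2.mp _ _ (hpers x y _ hy hx) hφ]
  · by_contra hcon
    obtain ⟨y, hy, hxy, hψ⟩ := h.exists_prime (h.isTheory_imp x.2.toIsTheory φ) hcon
    have hφy : φ ∈ y := hxy (x.2.subset (h.imp_self φ))
    have hxy' : x.1 ⊆ y := (h.subset_imp x.2.toIsTheory φ).trans hxy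
    refine hψ (hx ⟨y, hy⟩ ?_ hφy)
    by_cases hφx : φ ∈ x.1
    · exact absurd (hx x (Or.inl rfl) hφx) fun hψx => hψ (hxy' hψx)
    -- As `φ` is not in `x`, the axiom turns `⊠χ ∈ x` into `φ → χ ∈ x`; since `y` contains `x` and
    -- `φ`, it is an `R`-successor.
    · refine Or.inr fun χ hχ => ?_
      have := x.2.mp _ _ (x.2.subset (h.box_imp_or χ φ)) hχ
      exact hy.mp _ _ (hxy' ((x.2.prime _ _ this).resolve_left hφx)) hφy
  · by_contra hcon
    obtain ⟨y, hy, hxy, hφ⟩ := h.exists_prime (h.isTheory_box x.2.toIsTheory) hcon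
    exact hφ (hx ⟨y, hy⟩ fun χ hχ => hxy hχ)

theorem global_canonical {X : Set SimForm} (h : IsMHCTheory X) (φ : SimForm) :
    (∀ x : CanonicalWorld X, φ ∈ x.1) ↔ φ ∈ X := by
  refine ⟨fun hφ => ?_, fun hφ x => x.2.subset hφ⟩
  by_contra hcon
  obtain ⟨y, hy, -, hy'⟩ := h.exists_prime h.isTheory_self hcon
  exact hy' (hφ ⟨y, hy⟩)

/-! ### Rule systems of general frames -/

/-- The rules valid on a frame under the valuations in a set closed under
substitution. -/
def frameRules {W : Type} (R : W → W → Prop) (A : Set (ℕ → Set W))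
    (hA : ∀ V ∈ A, ∀ s : ℕ → ClmForm, (fun n => {x | Holds R V x (s n)}) ∈ A) :
    RuleSystem ClmForm where
  rules := {r | ∀ V ∈ A, (∀ γ ∈ r.1, ∀ x, Holds R V x γ) → ∃ δ ∈ r.2, ∀ x, Holds R V x δ}
  structurality s Γ Δ h V hV hΓ := by
    obtain ⟨δ, hδ, hx⟩ := h _ (hA V hV s) fun γ hγ x =>
      holds_subst.1 (hΓ _ (Finset.mem_image_of_mem _ hγ) x)
    exact ⟨_, Finset.mem_image_of_mem _ hδ, fun x => holds_subst.2 (hx x)⟩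
  reflexivity φ V _ h := ⟨φ, by simp, h φ (by simp)⟩
  monotonicity Γ Δ Γ' Δ' h V hV hΓ := by
    obtain ⟨δ, hδ, hx⟩ := h V hV fun γ hγ => hΓ γ (Finset.mem_union_left _ hγ)
    exact ⟨δ, Finset.mem_union_left _ hδ, hx⟩
  cut Γ Δ φ h h' V hV hΓ := by
    obtain ⟨δ, hδ, hx⟩ := h V hV hΓ
    rcases Finset.mem_insert.1 hδ with rfl | hδ
    · refine h' V hV fun γ hγ => ?_
      rcases Finset.mem_insert.1 hγ with rfl | hγ
      exacts [hx, hΓ γ hγ]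
    · exact ⟨δ, hδ, hx⟩
  modus_ponens φ ψ V _ h := by
    refine ⟨ψ, by simp, fun x => ?_⟩
    exact holds_imp.1 (h (ClmForm.imp φ ψ) (by simp [ModalLanguage.imp]) x) (h φ (by simp) x)
  necessitation φ V _ h :=
    ⟨box φ, Finset.mem_singleton_self _, fun _ y _ => h φ (by simp) y⟩

theorem K4_le_frameRules {W : Type} {R : W → W → Prop}
    (hR : ∀ x y z, R x y → R y z → R x z) {A : Set (ℕ → Set W)}
    {hA : ∀ V ∈ A, ∀ s : ℕ → ClmForm, (fun n => {x | Holds R V x (s n)}) ∈ A} :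
    K4 ≤ frameRules R A hA := by
  refine RuleSystem.generate_le ?_
  rintro r ⟨φ, hφ, rfl⟩ V _ _
  exact ⟨φ, by simp [ax], hφ W R hR V⟩

/-- The valuations by Boolean combinations of interpretations of `⊠`-formulae. -/
def combinationValuations {W : Type} (sat : W → SimForm → Prop) : Set (ℕ → Set W) :=
  Set.range fun (c : ℕ → Combination) n => {x | (c n).Eval (sat x)}

theorem combinationValuations_subst {W : Type} {R : W → W → Prop} {sat : W → SimForm → Prop}
    (h : IsSimModel R sat) :
    ∀ V ∈ combinationValuations sat, ∀ s : ℕ → ClmForm,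
      (fun n => {x | Holds R V x (s n)}) ∈ combinationValuations sat := by
  rintro _ ⟨c, rfl⟩ s
  refine ⟨fun n => SimForm.combination c (s n), ?_⟩
  funext n
  ext x
  exact (h.holds_combination c (s n) x).symm

/-- The rules valid on the general frame of Boolean combinations of interpretations. -/
def simModelRules {W : Type} {R : W → W → Prop} {sat : W → SimForm → Prop}
    (h : IsSimModel R sat) : RuleSystem ClmForm :=
  frameRules R (combinationValuations sat) (combinationValuations_subst h)

/-- No converse well-foundedness of `R` is needed. The hereditary part of an admissible value of `p`
is the truth set of a formula, and the KM axiom for that formula yields Löb's axiom for `p`. -/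
theorem GL_le_simModelRules {W : Type} {R : W → W → Prop} {sat : W → SimForm → Prop}
    (h : IsSimModel R sat)
    (hKM : ∀ (φ : SimForm) x, sat x (.imp (.imp (.box φ) φ) φ)) :
    GLSystem ≤ simModelRules h := by
  refine RuleSystem.adjoin_le (K4_le_frameRules h.trans) ?_
  rintro r rfl V ⟨c, rfl⟩ _
  refine ⟨_, Finset.mem_singleton_self _, fun x => ?_⟩
  have hop : ∀ y, sat y (SimForm.ofPred (c 0).1 (c 0).2) ↔
      ∀ z, y = z ∨ R y z → (c 0).Eval (sat z) := fun y => h.sat_ofPred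
  simp only [holds_imp, holds_box, holds_var]
  intro hx y hxy
  refine (hop y).1 ?_ y (Or.inl rfl)
  refine (h.imp _ _ _).1 (hKM _ y) y (Or.inl rfl) ((h.imp _ _ _).2 fun z hyz hz => ?_)
  have hxz : ∀ w, z = w ∨ R z w → R x w := fun w hw => by
    rcases h.rtrans hyz hw with rfl | hyw
    exacts [hxy, h.trans _ _ _ hxy hyw]
  rw [h.box] at hz
  refine (hop z).2 fun w hzw => hx w (hxz w hzw) fun v hwv => ?_
  have hzv : R z v := by
    rcases hzw with rfl | hzw
    exacts [hwv, h.trans _ _ _ hzw hwv]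
  exact (hop v).1 (hz v hzv) v (Or.inl rfl)

/-- Under an admissible valuation a translation only sees hereditary parts, so it evaluates as a
substitution instance; validity of translated rules then follows from structurality. -/
theorem holds_translate_combination {W : Type} {R : W → W → Prop} {sat : W → SimForm → Prop}
    (h : IsSimModel R sat) (c : ℕ → Combination) (φ : SimForm) (x : W) :
    Holds R (fun n => {y | (c n).Eval (sat y)}) x (translate φ) ↔
      sat x (φ.subst fun n => SimForm.ofPred (c n).1 (c n).2) :=
  h.sat_subst (isSimModel_translate _ h.trans)
    (fun _ _ => holds_boxPlus.trans h.sat_ofPred.symm) x φ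

theorem isMHCTheory_of_saturated {L : RuleSystem SimForm} (hL : KMSystem ≤ L)
    {X : Set SimForm} (hX : L.Saturated X) :
    IsMHCTheory X ∧ ∀ φ : SimForm, ((φ.box.imp φ).imp φ) ∈ X := by
  have hmHC : mHC ≤ L := (RuleSystem.le_adjoin _ _).trans hL
  have hgen := (RuleSystem.subset_generate _).trans hmHC
  have hax : ∀ φ : SimForm, ax φ ∈ L.rules → ∀ s, φ.subst s ∈ X := fun φ hφ s => by
    obtain ⟨δ, hδ, hδX⟩ := hX _ _ (L.ax_subst hφ s) (by simp)
    obtain rfl := Finset.mem_singleton.1 hδ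
    exact hδX
  refine ⟨⟨fun φ ψ h h' => ?_, fun φ h => ?_, fun s φ hφ => ?_, fun φ ψ => ?_, fun φ => ?_,
    fun φ ψ => ?_⟩, fun φ => ?_⟩
  · obtain ⟨δ, hδ, hδX⟩ := hX _ _ (L.modus_ponens φ ψ) (by
      simpa [Set.insert_subset_iff] using ⟨h', h⟩)
    obtain rfl := Finset.mem_singleton.1 hδ
    exact hδX
  · obtain ⟨δ, hδ, hδX⟩ := hX _ _ (L.necessitation φ) (by simpa using h)
    obtain rfl := Finset.mem_singleton.1 hδ
    exact hδX
  · exact hax _ (hgen (Or.inl ⟨φ, hφ, rfl⟩)) s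
  · exact hax _ (hgen (Or.inr (Or.inl rfl))) fun n => if n = 0 then φ else ψ
  · exact hax _ (hgen (Or.inr (Or.inr (Or.inl rfl)))) fun _ => φ
  · exact hax _ (hgen (Or.inr (Or.inr (Or.inr rfl)))) fun n => if n = 0 then φ else ψ
  · exact hax _ (hL (RuleSystem.subset_adjoin _ _ rfl)) fun _ => φ

theorem tau_le_sigma (L : RuleSystem SimForm) : tau L ≤ sigma L :=
  RuleSystem.subset_adjoin _ _

theorem translateRule_mem_sigma {L : RuleSystem SimForm} {r : Rule SimForm} (h : r ∈ L.rules) :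
    translateRule r ∈ (sigma L).rules :=
  tau_le_sigma L (RuleSystem.subset_adjoin _ _ ⟨r, h, rfl⟩)

theorem sigma_le {L : RuleSystem SimForm} {M : RuleSystem ClmForm} (hM : GLSystem ≤ M)
    (h : L.rules ⊆ rho M) : sigma L ≤ M := by
  refine RuleSystem.adjoin_le (K4Grz_le_GL.trans hM)
    (RuleSystem.adjoin_le (K4_le_GL.trans hM) ?_)
  rintro _ ⟨r, hr, rfl⟩
  exact h hr

/-- The general frame of the canonical model of a saturated `X` validates `σL`, while `X` separates
`Γ` from `Δ`. Saturation, not mere closure, is what handles several conclusions. -/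
theorem rho_sigma_subset {L : RuleSystem SimForm} (hL : KMSystem ≤ L) :
    rho (sigma L) ⊆ L.rules := by
  rintro ⟨Γ, Δ⟩ hr
  by_contra hcon
  obtain ⟨X, hX, hΓ, hΔ⟩ := L.exists_saturated hcon
  obtain ⟨hT, hKM⟩ := isMHCTheory_of_saturated hL hX
  have h := isSimModel_canonical hT
  have hσ : sigma L ≤ simModelRules h := by
    refine sigma_le (GL_le_simModelRules h fun φ x => x.2.subset (hKM φ)) ?_
    rintro ⟨Γ', Δ'⟩ hr' V ⟨c, rfl⟩ hV
    simp only [translateRule, Finset.forall_mem_image, Finset.exists_mem_image,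
      holds_translate_combination h, global_canonical hT] at hV ⊢
    obtain ⟨δ, hδ, hδX⟩ := hX _ _ (L.structurality _ _ _ hr') fun γ hγ => by
      obtain ⟨γ', hγ', rfl⟩ := Finset.mem_image.1 hγ
      exact hV hγ'
    obtain ⟨δ', hδ', rfl⟩ := Finset.mem_image.1 hδ
    exact ⟨δ', hδ', hδX⟩
  -- The tautological valuation, sending each variable to its own truth set, under which `T(φ)` and
  -- `φ` agree.
  let c : ℕ → Combination := fun n => ({.var n}, fun A => .var n ∈ A)
  have hc : ∀ φ (x : CanonicalWorld X),
      Holds (canonicalRel X) (fun n => {y | (c n).Eval fun φ => φ ∈ y.1}) x (translate φ) ↔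
        φ ∈ x.1 := fun φ x => by
    have h' := isSimModel_translate (fun n => {y | (c n).Eval fun φ => φ ∈ y.1}) h.trans
    induction φ generalizing x with
    | var n =>
      refine holds_boxPlus.trans ⟨fun hx => ?_, fun hx y hy => ?_⟩
      · simpa [c, Combination.Eval] using hx x (Or.inl rfl)
      · simpa [c, Combination.Eval] using h.persist' hy hx
    | bot => simp [h.bot, h'.bot]
    | top => simp [h.top, h'.top]
    | and φ ψ ih ih' => simp only [h.and, h'.and, ih, ih']
    | or φ ψ ih ih' => simp only [h.or, h'.or, ih, ih']
    | imp φ ψ ih ih' => simp only [h.imp, h'.imp, ih, ih']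
    | box φ ih => simp only [h.box, h'.box, ih]
  obtain ⟨δ, hδ, hδX⟩ := hσ hr _ ⟨c, rfl⟩ fun γ hγ => by
    obtain ⟨γ', hγ', rfl⟩ := Finset.mem_image.1 hγ
    simp only [hc, global_canonical hT]
    exact hΓ hγ'
  obtain ⟨δ', hδ', rfl⟩ := Finset.mem_image.1 hδ
  simp only [hc, global_canonical hT] at hδX
  exact hΔ δ' hδ' hδX

/-! ### The isomorphism -/

/-- The argument of `GL_le_simModelRules`, with `T(p) = □⁺p` as the hereditary part of `p`. -/
theorem GL_le_sigma_KM : GLSystem ≤ sigma KMSystem := by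
  have hK : K4 ≤ sigma KMSystem := (RuleSystem.le_adjoin _ _).trans (tau_le_sigma _)
  refine RuleSystem.adjoin_le hK ?_
  rintro r rfl
  have hax := translateRule_mem_sigma (L := KMSystem) (RuleSystem.subset_adjoin _ _ rfl)
  rw [translateRule_ax] at hax
  refine derives_of_global hK {_} _ (by simpa using hax) fun W R V hR h _ x => ?_
  have h := h _ (Finset.mem_singleton_self _)
  have hsat := isSimModel_translate V hR
  have hv : ∀ y, Holds R V y (translate (.var 0)) ↔ ∀ z, y = z ∨ R y z → z ∈ V 0 :=
    fun y => holds_boxPlus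
  simp only [holds_imp, holds_box, holds_var]
  intro hx y hxy
  refine (hv y).1 ?_ y (Or.inl rfl)
  refine (hsat.imp _ _ _).1 (h y) y (Or.inl rfl) ((hsat.imp _ _ _).2 fun z hyz hz => ?_)
  have hxz : ∀ w, z = w ∨ R z w → R x w := fun w hw => by
    rcases hsat.rtrans hyz hw with rfl | hyw
    exacts [hxy, hR _ _ _ hxy hyw]
  refine (hv z).2 fun w hzw => hx w (hxz w hzw) fun v hwv => ?_
  have hzv : R z v := by
    rcases hzw with rfl | hzw
    exacts [hwv, hR _ _ _ hzw hwv]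
  exact (hv v).1 ((hsat.box _ _).1 hz v hzv) v (Or.inl rfl)

theorem sigma_mono {L L' : RuleSystem SimForm} (h : L ≤ L') : sigma L ≤ sigma L' := by
  refine RuleSystem.adjoin_le (RuleSystem.le_adjoin _ _) (RuleSystem.adjoin_le
    ((RuleSystem.le_adjoin _ _).trans (tau_le_sigma _)) ?_)
  rintro _ ⟨r, hr, rfl⟩
  exact translateRule_mem_sigma (h hr)

theorem sigma_KM : sigma KMSystem = GLSystem :=
  le_antisymm (sigma_le le_rfl (KM_le_rhoSystem le_rfl)) GL_le_sigma_KM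

theorem GL_le_sigma {L : RuleSystem SimForm} (hL : KMSystem ≤ L) : GLSystem ≤ sigma L :=
  GL_le_sigma_KM.trans (sigma_mono hL)

theorem rho_sigma {L : RuleSystem SimForm} (hL : KMSystem ≤ L) : rho (sigma L) = L.rules :=
  (rho_sigma_subset hL).antisymm fun _ => translateRule_mem_sigma

/-- One inclusion is minimality of `σ`. For the other, `σρM` contains every translated rule of `M`,
and these determine systems above GL. -/
theorem sigma_rho {M : RuleSystem ClmForm} (hM : GLSystem ≤ M) :
    sigma (rhoSystem (K4_le_GL.trans hM)) = M :=
  le_antisymm (sigma_le hM subset_rfl) (le_of_rho_subset hM (GL_le_sigma (KM_le_rhoSystem hM))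
    fun _ => translateRule_mem_sigma (L := rhoSystem (K4_le_GL.trans hM)))

/-- The isomorphism given by `σ` and `ρ`. -/
def sigmaRhoIso : NExt KMSystem ≃o NExt GLSystem where
  toFun L := ⟨sigma L.1, GL_le_sigma L.2⟩
  invFun M := ⟨rhoSystem (K4_le_GL.trans M.2), KM_le_rhoSystem M.2⟩
  left_inv L := Subtype.ext (RuleSystem.ext (rho_sigma L.2))
  right_inv M := Subtype.ext (sigma_rho M.2)
  map_rel_iff' {L L'} := by
    refine ⟨fun h => ?_, fun h => sigma_mono (L := L.1) (L' := L'.1) h⟩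
    -- The order is reflected by applying the monotone `ρ` and cancelling `ρσ`.
    have h' : rho (sigma L.1) ⊆ rho (sigma L'.1) := fun r hr => h hr
    rwa [rho_sigma L.2, rho_sigma L'.2] at h'

end ModalRules

theorem mainTheorem2 :
    ModalRules.sigma ModalRules.KMSystem = ModalRules.GLSystem ∧
    ∃ e : ModalRules.NExt ModalRules.KMSystem ≃o ModalRules.NExt ModalRules.GLSystem,
      (∀ L, (e L).toRuleSystem = ModalRules.sigma L.toRuleSystem) ∧
      (∀ M, (e.symm M).toRuleSystem.rules = ModalRules.rho M.toRuleSystem) ∧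
      (∀ 𝒮 : Set (ModalRules.NExt ModalRules.KMSystem), e (sSup 𝒮) = sSup (e '' 𝒮)) ∧
      (∀ 𝒮 : Set (ModalRules.NExt ModalRules.KMSystem), e (sInf 𝒮) = sInf (e '' 𝒮)) ∧
      (∀ 𝒮 : Set (ModalRules.NExt ModalRules.GLSystem), e.symm (sSup 𝒮) = sSup (e.symm '' 𝒮)) ∧
      (∀ 𝒮 : Set (ModalRules.NExt ModalRules.GLSystem), e.symm (sInf 𝒮) = sInf (e.symm '' 𝒮)) := by
  refine ⟨ModalRules.sigma_KM, ModalRules.sigmaRhoIso, fun _ => rfl, fun _ => rfl, ?_, ?_, ?_, ?_⟩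
  · exact fun 𝒮 => (OrderIso.map_sSup _ 𝒮).trans sSup_image.symm
  · exact fun 𝒮 => (OrderIso.map_sInf _ 𝒮).trans sInf_image.symm
  · exact fun 𝒮 => (OrderIso.map_sSup _ 𝒮).trans sSup_image.symm
  · exact fun 𝒮 => (OrderIso.map_sInf _ 𝒮).trans sInf_image.symm
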